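/- Conventions. A quandle is a set $X$ with an operation $\triangleleft$ that is idempotent and such that every right translation $-\triangleleft b$ is a bijective endomorphism; it is abelian if $(a\triangleleft b)\triangleleft c=(a\triangleleft c)\triangleleft b$. Its structure group is $G(X)=\langle g_a,\ a\in X\mid g_ag_b=g_bg_{a\triangleleft b}\rangle$. Its second (rack) homology is $H_2(X)=\ker d_2/\operatorname{im} d_3$, where $d_2\colon\mathbb Z X^2\to\mathbb Z X$, $d_3\colon \mathbb Z X^3\to\mathbb Z X^2$ are given by $d_2(a,b)=a\triangleleft b-a$ and $d_3(a,b,c)=(a\triangleleft b,c)-(a,c)-(a\triangleleft c,b\triangleleft c)+(a,b)$. For $a\in X$, the path map $p_a\colon G(X)\to \mathbb Z X^2/\operatorname{im}d_3$ sends $g$, written as a word in the generators $g_b^{\pm1}$, to the class of the path that starts at $a$ and follows the letters of the word: a letter $g_b$ moves from $x$ to $x\triangleleft b$ and contributes $(x,b)$, and a letter $g_b^{-1}$ moves from $y\triangleleft b$ to $y$ and contributes $-(y,b)$. For a finite abelian quandle with orbits $O_1,\dots,O_r$, the torsion group $T_i\subseteq H_2(X)$ is the image under $p_a$ of the commutator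 subgroup of $G(X)$, for any $a\in O_i$. Parameters. Let $r\ge 2$. For a lower triangular integer matrix $M=(m_{k,l})_{1\le l\le k<r}$ with $m_{k,k}\ge1$ and $0\le m_{k,l}<m_{l,l}$ for $l<k$, let $G(M)$ be the abelian group generated by $x_1,\dots,x_{r-1}$ with relations $x_1^{m_{k,1}}\cdots x_k^{m_{k,k}}=1$ for $1\le k<r$, and put $x_0=1$. Given such matrices $M^{(1)},\dots,M^{(r)}$, let $Q(M^{(1)},\dots,M^{(r)})=\bigsqcup_i G(M^{(i)})$ with $a\triangleleft b=a\,x^{(i)}_{j-i}$ for $a\in G(M^{(i)})$, $b\in G(M^{(j)})$ (the index $j-i$ is taken modulo $r$). This is an abelian quandle with orbits $G(M^{(i)})$. The matrices $M^{(i)}$ are called parameters of a finite quandle $X$ with ordered orbits $O_1,\dots,O_r$ if $X$ is isomorphic to $Q(M^{(1)},\dots,M^{(r)})$ by an isomorphism taking $O_i$ to $G(M^{(i)})$ for every $i$; the parameter group of $X$ is then $$G'(X)=\Big(\prod_{i=1}^r G(M^{(i)})\Big)\Big/\big\langle x^{(i)}_{j-i}\,x^{(j)}_{i-j}\ :\ 1\le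 i<j\le r\big\rangle .$$ Proposition. Let $r\ge 3$, let $n_1,\dots,n_r$ be positive integers, and let $U_{n_1,\dots,n_r}=\bigsqcup_{i=1}^r O_i$ with $O_i=\mathbb Z_{n_i}=\mathbb Z/n_i\mathbb Z$ be the abelian quandle with $a\triangleleft b=a$ if $a,b$ lie in the same $O_i$, and $a\triangleleft b=a+1$ otherwise. Its orbits are $O_1,\dots,O_r$, in this order. Then: 1. $U_{n_1,\dots,n_r}$ has parameters, and its parameter group is $G'(U_{n_1,\dots,n_r})\cong\mathbb Z_{\gcd(n_1,\dots,n_r,2)}$. 2. If $r=3$, then $H_2(U_{n_1,n_2,n_3})\cong\mathbb Z^9\oplus(\mathbb Z_{\gcd(n_1,n_2,n_3,2)})^3$, and all torsion groups are isomorphic to the whole parameter group: $T_1\cong T_2\cong T_3\cong G'(U_{n_1,n_2,n_3})$. 3. If $r\ge4$, then there is no torsion: $H_2(U_{n_1,\dots,n_r})\cong\mathbb Z^{r^2}$, and all the torsion groups $T_i$ are trivial. -/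

import Mathlib

/-!
Conventions. Quandles are Mathlib's (left) quandles. The right-handed operation of the text is
recovered by reading `b ◃ a` as "`a` acted on by `b`"; the right translation by `b` is the
bijection `a ↦ b ◃ a`. Abelian groups are written additively.
-/

namespace AbQuandle

open Quandles

/-! ### Second rack homology -/

section Homology

variable (X : Type*) [Rack X]

/-- `d₂ (a, b) = (a ◁ b) - a`, where `a ◁ b` is `b ◃ a`. -/
noncomputable def d2 : (X × X →₀ ℤ) →+ (X →₀ ℤ) :=
  Finsupp.liftAddHom fun p =>
    zmultiplesHom (X →₀ ℤ) (Finsupp.single (p.2 ◃ p.1) 1 - Finsupp.single p.1 1)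

/-- `d₃ (a, b, c) = (a ◁ b, c) - (a, c) - (a ◁ c, b ◁ c) + (a, b)`. -/
noncomputable def d3 : (X × X × X →₀ ℤ) →+ (X × X →₀ ℤ) :=
  Finsupp.liftAddHom fun p =>
    zmultiplesHom (X × X →₀ ℤ)
      (Finsupp.single (p.2.1 ◃ p.1, p.2.2) 1 - Finsupp.single (p.1, p.2.2) 1
        - Finsupp.single (p.2.2 ◃ p.1, p.2.2 ◃ p.2.1) 1 + Finsupp.single (p.1, p.2.1) 1)

theorem d2_single (a b : X) :
    d2 X (Finsupp.single (a, b) 1) = Finsupp.single (b ◃ a) 1 - Finsupp.single a 1 := by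
  simp [d2]

theorem d3_single (a b c : X) :
    d3 X (Finsupp.single (a, b, c) 1) =
      Finsupp.single (b ◃ a, c) 1 - Finsupp.single (a, c) 1
        - Finsupp.single (c ◃ a, c ◃ b) 1 + Finsupp.single (a, b) 1 := by
  simp [d3]

theorem d2_comp_d3 : (d2 X).comp (d3 X) = 0 := by
  refine Finsupp.addHom_ext' fun p => AddMonoidHom.ext_int ?_
  obtain ⟨a, b, c⟩ := p
  simp only [AddMonoidHom.comp_apply, Finsupp.singleAddHom_apply, d3_single, map_add, map_sub,
    d2_single, ← Shelf.self_distrib, AddMonoidHom.zero_apply]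
  abel

/-- `Q₂ = C₂ / B₂`, the quotient of the 2-chains by the 2-boundaries. -/
abbrev Q2 : Type _ := (X × X →₀ ℤ) ⧸ (d3 X).range

/-- The map `C₂ / B₂ → C₁` induced by `d₂`. -/
noncomputable def d2bar : Q2 X →+ (X →₀ ℤ) :=
  QuotientAddGroup.lift (d3 X).range (d2 X) (by
    rintro _ ⟨x, rfl⟩
    exact DFunLike.congr_fun (d2_comp_d3 X) x)

/-- The second rack homology group `H₂ = Z₂ / B₂`, as a subgroup of `C₂ / B₂`. -/
noncomputable def H2 : AddSubgroup (Q2 X) := (d2bar X).ker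

variable {X}

/-- The class of the generator `(a, b)` in `C₂ / B₂`. -/
noncomputable def edge (a b : X) : Q2 X := QuotientAddGroup.mk (Finsupp.single (a, b) 1)

theorem edge_square (a b c : X) :
    edge a b + edge (b ◃ a) c = edge a c + edge (c ◃ a) (c ◃ b) := by
  have h : (QuotientAddGroup.mk (d3 X (Finsupp.single (a, b, c) 1)) : Q2 X) = 0 :=
    (QuotientAddGroup.eq_zero_iff _).2 ⟨_, rfl⟩
  rw [d3_single] at h
  simp only [QuotientAddGroup.mk_add, QuotientAddGroup.mk_sub] at h
  rw [← sub_eq_zero, ← h]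
  unfold edge
  abel

end Homology

/-! ### Structure group, path maps, torsion groups -/

section StructureGroup

variable (X : Type*) [Rack X]

/-- The relators of `g_a g_b = g_b g_{a ◁ b}`. -/
def structureRels : Set (FreeGroup X) :=
  {w | ∃ a b : X, w = FreeGroup.of a * FreeGroup.of b *
    (FreeGroup.of b * FreeGroup.of (b ◃ a))⁻¹}

/-- The structure group `⟨g_a (a ∈ X) | g_a g_b = g_b g_{a ◁ b}⟩`. -/
abbrev StructureGroup : Type _ := PresentedGroup (structureRels X)

variable {X}

/-- One step along an edge labelled `b`, recording the vertex and the chain traversed so far: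
`(a, q) ↦ (a ◁ b, q + (a, b))`. -/
noncomputable def stepPerm (b : X) : Equiv.Perm (X × Q2 X) where
  toFun p := (b ◃ p.1, p.2 + edge p.1 b)
  invFun p := (b ◃⁻¹ p.1, p.2 - edge (b ◃⁻¹ p.1) b)
  left_inv p := by simp
  right_inv p := by simp

/-- Walking along a word in the generators `g_b`, read from left to right, a letter `g_b⁻¹` being
an edge labelled `b` traversed backwards. The opposite group appears because this is a right
action. -/
noncomputable def walk : StructureGroup X →* (Equiv.Perm (X × Q2 X))ᵐᵒᵖ :=
  PresentedGroup.toGroup (f := fun b => MulOpposite.op (stepPerm b)) (by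
    rintro _ ⟨a, b, rfl⟩
    rw [map_mul, map_inv, mul_inv_eq_one]
    simp only [map_mul, FreeGroup.lift_apply_of, ← MulOpposite.op_mul]
    congr 1
    ext1 ⟨x, q⟩
    refine Prod.ext ?_ ?_
    · exact Shelf.self_distrib
    · change q + edge x a + edge (a ◃ x) b = q + edge x b + edge (b ◃ x) (b ◃ a)
      rw [add_assoc, add_assoc, edge_square])

/-- The end vertex `a · g` of the path starting at `a` and labelled by `g`. -/
noncomputable def endVertex (a : X) (g : StructureGroup X) : X := ((walk g).unop (a, 0)).1

/-- The path map `p_a : G → C₂ / B₂`. -/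
noncomputable def pathMap (a : X) (g : StructureGroup X) : Q2 X := ((walk g).unop (a, 0)).2

theorem walk_apply (g : StructureGroup X) :
    ∀ (a : X) (q : Q2 X), (walk g).unop (a, q) = (endVertex a g, q + pathMap a g) := by
  have key : ∀ (g : StructureGroup X) (a : X) (q q' : Q2 X),
      (walk g).unop (a, q + q') =
        (((walk g).unop (a, q')).1, q + ((walk g).unop (a, q')).2) := by
    intro g
    have hof : ∀ (b : X) (p : X × Q2 X),
        (walk (PresentedGroup.of b)).unop p = stepPerm b p := by
      intro b p
      simp [walk]
    obtain ⟨w, rfl⟩ := QuotientGroup.mk_surjective g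
    induction w using FreeGroup.induction_on with
    | C1 => intro a q q'; rfl
    | of b =>
      intro a q q'
      refine ((hof b _).trans ?_).trans
        (congrArg (fun p : X × Q2 X => (p.1, q + p.2)) (hof b (a, q')).symm)
      exact Prod.ext rfl (add_assoc _ _ _)
    | inv_of b _ =>
      intro a q q'
      have hinv : ∀ p : X × Q2 X,
          (walk (QuotientGroup.mk (FreeGroup.of b)⁻¹ : StructureGroup X)).unop p
            = (stepPerm b).symm p := by
        intro p
        have h1 : (QuotientGroup.mk (FreeGroup.of b)⁻¹ : StructureGroup X)
            = (PresentedGroup.of b)⁻¹ := rfl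
        have h2 : (walk (PresentedGroup.of b : StructureGroup X)).unop = stepPerm b :=
          Equiv.ext (hof b)
        rw [h1, map_inv, MulOpposite.unop_inv, h2, Equiv.Perm.inv_def]
      refine ((hinv _).trans ?_).trans
        (congrArg (fun p : X × Q2 X => (p.1, q + p.2)) (hinv (a, q')).symm)
      exact Prod.ext rfl (add_sub_assoc _ _ _)
    | mul x y hx hy =>
      intro a q q'
      have hm : ∀ p : X × Q2 X,
          (walk (QuotientGroup.mk (x * y) : StructureGroup X)).unop p
            = (walk (QuotientGroup.mk y : StructureGroup X)).unop
              ((walk (QuotientGroup.mk x : StructureGroup X)).unop p) := by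
        intro p
        exact congrArg (fun s : (Equiv.Perm (X × Q2 X))ᵐᵒᵖ => s.unop p)
          (walk.map_mul (QuotientGroup.mk x : StructureGroup X) (QuotientGroup.mk y))
      rw [hm, hm, hx, hy]
  intro a q
  have := key g a q 0
  rwa [add_zero] at this

theorem pathMap_one (a : X) : endVertex a 1 = a ∧ pathMap a 1 = 0 := by
  simp [endVertex, pathMap]

theorem walk_mul (a : X) (g h : StructureGroup X) :
    endVertex a (g * h) = endVertex (endVertex a g) h ∧
      pathMap a (g * h) = pathMap a g + pathMap (endVertex a g) h := by
  have h1 : (walk (g * h)).unop (a, 0) = (walk h).unop ((walk g).unop (a, 0)) := by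
    rw [map_mul, MulOpposite.unop_mul, Equiv.Perm.mul_apply]
  rw [walk_apply, walk_apply g, walk_apply h] at h1
  simpa [Prod.ext_iff] using h1

/-- The torsion group attached to the orbit of `a`: the image under the path map `p_a` of the
commutator subgroup of the structure group, taken inside the stabiliser of `a`, on which `p_a` is
a homomorphism (for an abelian quandle the commutator subgroup acts trivially, so the stabiliser
condition is automatic, see `endVertex_of_mem_commutator`). -/
noncomputable def torsionGroup (a : X) : AddSubgroup (Q2 X) where
  carrier := {q | ∃ g ∈ commutator (StructureGroup X), endVertex a g = a ∧ pathMap a g = q}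
  zero_mem' := ⟨1, one_mem _, pathMap_one a⟩
  add_mem' := by
    rintro _ _ ⟨g, hg, hga, rfl⟩ ⟨h, hh, hha, rfl⟩
    refine ⟨g * h, mul_mem hg hh, ?_, ?_⟩
    · rw [(walk_mul a g h).1, hga, hha]
    · rw [(walk_mul a g h).2, hga]
  neg_mem' := by
    rintro _ ⟨g, hg, hga, rfl⟩
    have h1 := walk_mul a g g⁻¹
    rw [mul_inv_cancel, hga, (pathMap_one a).1, (pathMap_one a).2] at h1
    exact ⟨g⁻¹, inv_mem hg, h1.1.symm, (neg_eq_of_add_eq_zero_right h1.2.symm).symm⟩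

/-- A rack is abelian if `(a ◁ b) ◁ c = (a ◁ c) ◁ b`. -/
def IsAbelian (X : Type*) [Rack X] : Prop := ∀ a b c : X, c ◃ (b ◃ a) = b ◃ (c ◃ a)

theorem endVertex_of (a b : X) : endVertex a (PresentedGroup.of b) = b ◃ a := by
  simp [endVertex, walk, stepPerm]

theorem endVertex_comm (hX : IsAbelian X) (g h : StructureGroup X) (a : X) :
    endVertex (endVertex a g) h = endVertex (endVertex a h) g := by
  have ind : ∀ (P : StructureGroup X → Prop), P 1 → (∀ b, P (PresentedGroup.of b)) →
      (∀ x, P x → P x⁻¹) → (∀ x y, P x → P y → P (x * y)) → ∀ g, P g := by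
    intro P h1 h2 h3 h4 g
    obtain ⟨w, rfl⟩ := QuotientGroup.mk_surjective g
    induction w using FreeGroup.induction_on with
    | C1 => exact h1
    | of b => exact h2 b
    | inv_of b _ => exact h3 _ (h2 b)
    | mul x y hx hy => exact h4 _ _ hx hy
  have hinv : ∀ (x : StructureGroup X) (a : X),
      endVertex (endVertex a x) x⁻¹ = a ∧ endVertex (endVertex a x⁻¹) x = a := by
    intro x a
    rw [← (walk_mul a x x⁻¹).1, ← (walk_mul a x⁻¹ x).1, mul_inv_cancel, inv_mul_cancel]
    exact ⟨(pathMap_one a).1, (pathMap_one a).1⟩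
  have ext1 : ∀ k : StructureGroup X,
      (∀ b a, endVertex (endVertex a (PresentedGroup.of b)) k
        = endVertex (endVertex a k) (PresentedGroup.of b)) →
      ∀ g a, endVertex (endVertex a g) k = endVertex (endVertex a k) g := by
    intro k hk g
    refine ind (fun g => ∀ a, endVertex (endVertex a g) k = endVertex (endVertex a k) g)
      ?_ ?_ ?_ ?_ g
    · intro a; rw [(pathMap_one _).1, (pathMap_one _).1]
    · intro b a; exact hk b a
    · intro x hx a
      have := hx (endVertex a x⁻¹)
      rw [(hinv x a).2] at this
      rw [this, (hinv x _).1]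
    · intro x y hx hy a
      rw [(walk_mul _ x y).1, (walk_mul _ x y).1, hy, hx]
  refine ext1 h (fun b a => ?_) g a
  refine (ext1 (PresentedGroup.of b) (fun c a => ?_) h a).symm
  simp only [endVertex_of]
  exact hX a c b

theorem endVertex_of_mem_commutator (hX : IsAbelian X) {g : StructureGroup X}
    (hg : g ∈ commutator (StructureGroup X)) (a : X) : endVertex a g = a := by
  let S : Subgroup (StructureGroup X) :=
    { carrier := {g | ∀ a, endVertex a g = a}
      one_mem' := fun a => (pathMap_one a).1
      mul_mem' := fun {x y} hx hy a => by rw [(walk_mul a x y).1, hx a, hy a]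
      inv_mem' := fun {x} hx a => by
        have h1 := (walk_mul a x x⁻¹).1
        rw [mul_inv_cancel, (pathMap_one a).1, hx a] at h1
        exact h1.symm }
  have hS : commutator (StructureGroup X) ≤ S := by
    rw [commutator_def, Subgroup.commutator_le]
    intro x _ y _ a
    rw [commutatorElement_def, (walk_mul a (x * y * x⁻¹) y⁻¹).1,
      (walk_mul a (x * y) x⁻¹).1, (walk_mul a x y).1, endVertex_comm hX y x⁻¹,
      ← (walk_mul a x x⁻¹).1, mul_inv_cancel, (pathMap_one a).1,
      ← (walk_mul a y y⁻¹).1, mul_inv_cancel, (pathMap_one a).1]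
  exact hS hg a

theorem torsionGroup_le_H2 (a : X) : torsionGroup a ≤ H2 X := by
  have key : ∀ (g : StructureGroup X) (a : X),
      d2bar X (pathMap a g) = Finsupp.single (endVertex a g) 1 - Finsupp.single a 1 := by
    intro g
    have hone : ∀ a : X, d2bar X (pathMap a 1)
        = Finsupp.single (endVertex a 1) 1 - Finsupp.single a 1 := by
      intro a
      rw [(pathMap_one a).1, (pathMap_one a).2, map_zero, sub_self]
    have hof : ∀ b a : X, d2bar X (pathMap a (PresentedGroup.of b))
        = Finsupp.single (endVertex a (PresentedGroup.of b)) 1 - Finsupp.single a 1 := by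
      intro b a
      have : pathMap a (PresentedGroup.of b) = edge a b := by
        simp [pathMap, walk, stepPerm]
      rw [this, endVertex_of]
      exact d2_single X a b
    have hinv : ∀ x : StructureGroup X, (∀ a, d2bar X (pathMap a x)
        = Finsupp.single (endVertex a x) 1 - Finsupp.single a 1) →
        ∀ a, d2bar X (pathMap a x⁻¹)
          = Finsupp.single (endVertex a x⁻¹) 1 - Finsupp.single a 1 := by
      intro x hx a
      have h1 := walk_mul a x⁻¹ x
      rw [inv_mul_cancel, (pathMap_one a).1, (pathMap_one a).2] at h1
      have h2 := hx (endVertex a x⁻¹)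
      rw [← h1.1] at h2
      rw [eq_neg_of_add_eq_zero_left h1.2.symm, map_neg, h2, neg_sub]
    have hmul : ∀ x y : StructureGroup X, (∀ a, d2bar X (pathMap a x)
        = Finsupp.single (endVertex a x) 1 - Finsupp.single a 1) →
        (∀ a, d2bar X (pathMap a y)
          = Finsupp.single (endVertex a y) 1 - Finsupp.single a 1) →
        ∀ a, d2bar X (pathMap a (x * y))
          = Finsupp.single (endVertex a (x * y)) 1 - Finsupp.single a 1 := by
      intro x y hx hy a
      rw [(walk_mul a x y).1, (walk_mul a x y).2, map_add, hx, hy]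
      abel
    obtain ⟨w, rfl⟩ := QuotientGroup.mk_surjective g
    induction w using FreeGroup.induction_on with
    | C1 => exact hone
    | of b => exact hof b
    | inv_of b _ => exact hinv _ (hof b)
    | mul x y hx hy => exact hmul _ _ hx hy
  rintro _ ⟨g, -, hga, rfl⟩
  change d2bar X (pathMap a g) = 0
  rw [key, hga, sub_self]

end StructureGroup

/-! ### Filtered-permutation quandles and parameters -/

/-- A lower triangular integer matrix of size `r - 1` with `1 ≤ m_{i,i}` and
`0 ≤ m_{j,i} < m_{i,i}` for `i < j` (indices start at `0`). -/
structure FPMatrix (r : ℕ) where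
  m : Fin (r - 1) → Fin (r - 1) → ℤ
  upper : ∀ i j, i < j → m i j = 0
  diag_pos : ∀ i, 1 ≤ m i i
  lower_nonneg : ∀ i j, i < j → 0 ≤ m j i
  lower_lt : ∀ i j, i < j → m j i < m i i

namespace FPMatrix

variable {r : ℕ} (M : FPMatrix r)

/-- `G(M)`: the abelian group on `x_1, …, x_{r-1}` with one relation for each row of `M`. -/
abbrev Grp : Type := (Fin (r - 1) → ℤ) ⧸ AddSubgroup.closure (Set.range M.m)

/-- The generator `x_k` of `G(M)` for `0 ≤ k < r`, with `x_0 = 0`. -/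
def gen (k : Fin r) : M.Grp :=
  if h : k.val = 0 then 0
  else QuotientAddGroup.mk (Pi.single (⟨k.val - 1, by have := k.isLt; omega⟩ : Fin (r - 1)) 1)

end FPMatrix

section FP

variable {r : ℕ} (M : Fin r → FPMatrix r)

/-- The underlying set of the filtered-permutation quandle `Q(M⁽¹⁾, …, M⁽ʳ⁾)`. -/
structure FPQuandle where
  index : Fin r
  val : (M index).Grp

/-- `a ◁ b = a x_{j - i}` for `a ∈ G(M⁽ⁱ⁾)`, `b ∈ G(M⁽ʲ⁾)`, with `j - i` taken modulo `r`. -/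
instance : Quandle (FPQuandle M) where
  act b a := ⟨a.index, a.val + (M a.index).gen (b.index - a.index)⟩
  self_distrib := by
    rintro ⟨i, a⟩ ⟨j, b⟩ ⟨k, c⟩
    simp only [add_right_comm]
  invAct b a := ⟨a.index, a.val - (M a.index).gen (b.index - a.index)⟩
  left_inv := by rintro ⟨i, a⟩ ⟨j, b⟩; simp
  right_inv := by rintro ⟨i, a⟩ ⟨j, b⟩; simp
  fix := by
    rintro ⟨i, a⟩
    have : ((i - i : Fin r)).val = 0 := by
      have := i.isLt
      simp [Fin.sub_def, Nat.sub_add_cancel this.le]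
    simp [FPMatrix.gen, this]

/-- The quandle `X`, with its orbits ordered by the labelling `o`, is isomorphic to the
filtered-permutation quandle of `M` by an isomorphism matching the `i`-th orbit with the `i`-th
component. -/
def HasParameters (X : Type*) [Quandle X] (o : X → Fin r) : Prop :=
  ∃ e : X ≃ FPQuandle M, (∀ a b : X, e (b ◃ a) = e b ◃ e a) ∧ ∀ a : X, (e a).index = o a

/-- The parameter group: the quotient of `∏ᵢ G(M⁽ⁱ⁾)` by the elements
`x⁽ⁱ⁾_{j-i} + x⁽ʲ⁾_{i-j}` for `i < j`, indices modulo `r`. -/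
abbrev ParameterGroup : Type :=
  (∀ i : Fin r, (M i).Grp) ⧸ AddSubgroup.closure
    {v : ∀ i : Fin r, (M i).Grp | ∃ i j : Fin r, i < j ∧
      v = Pi.single i ((M i).gen (j - i)) + Pi.single j ((M j).gen (i - j))}

end FP

/-! ### The quandles `U_{n_1, …, n_r}` -/

section U

variable {r : ℕ} (n : Fin r → ℕ)

/-- `U_{n_1, …, n_r}`: the disjoint union of the sets `O_i = ℤ / n_i`. -/
structure U where
  index : Fin r
  val : ZMod (n index)

/-- `a ◁ b` is `a` if `a`, `b` lie in the same component, and `a + 1` otherwise. -/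
instance : Quandle (U n) where
  act b a := ⟨a.index, if a.index = b.index then a.val else a.val + 1⟩
  self_distrib := by
    rintro ⟨i, a⟩ ⟨j, b⟩ ⟨k, c⟩
    by_cases h1 : k = i <;> by_cases h2 : k = j <;> simp [h1, h2]
  invAct b a := ⟨a.index, if a.index = b.index then a.val else a.val - 1⟩
  left_inv := by
    rintro ⟨i, a⟩ ⟨j, b⟩
    by_cases h : j = i <;> simp [h]
  right_inv := by
    rintro ⟨i, a⟩ ⟨j, b⟩
    by_cases h : j = i <;> simp [h]
  fix := by
    rintro ⟨i, a⟩
    simp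

theorem isAbelian_U : IsAbelian (U n) := by
  rintro ⟨i, a⟩ ⟨j, b⟩ ⟨k, c⟩
  by_cases h1 : i = j <;> by_cases h2 : i = k <;> simp [Shelf.act, h1, h2]

end U

end AbQuandle

/-! Every relation in C₂/B₂ is a square, and for U it depends only on which of a, b, c share an
orbit. Fix for each orbit O_i another orbit O_{β i}. The squares show that one class τ_i measures
two changes at once: for a in O_i, replacing b by b + 1 in any other orbit adds τ_i to (a, b), and
replacing a by a + 1 adds τ_i to (a, c) for c in O_i (`edge_succ_right`, `edge_succ_left`). Going
once around O_j gives n_j τ_i = 0 for every j.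

Write δ_c(a) = (a + 1, c) - (a, c). For b, c in distinct orbits other than O_i, the square says
δ_c(a) = δ_b(a) + τ_i. Exchanging b and c gives 2τ_i = 0. With a third such orbit, two steps must
equal one step, so τ_i = 0 once r ≥ 4. Commutators of generators evaluate to 0 or ±τ_i along paths
from O_i, so τ_i generates T_i (`torsionGroup_eq_zmultiples`).

That nothing more collapses is shown by a functional: for r = 3 and d = gcd(n_1, …, n_r, 2),
`torsionCoord` maps C₂/B₂ to ℤ/d and sends τ_i to 1. For r ≥ 4 the same statements are used with d =
1.

For the homology, d₂ sees only the edges that change orbit: it is (shift - 1) applied to their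
0-chain of initial vertices (`d2bar_eq_sources`). A cycle therefore has sources constant on each
orbit. `chain_normal_form` rebuilds a chain from its sources, its edge counts between orbits and its
torsion coordinates, so a cycle is given by r source multiplicities, r² - r edge counts and r
elements of ℤ/d. Explicit cycles realise all values.

On the parameter side, an isomorphism with U forces each G(M⁽ⁱ⁾) to be ℤ/n_i with every nontrivial
x_k equal to one generator c_i. The relations c_i + c_j = 0 then make all c_i equal and killed by 2
as soon as r ≥ 3. -/

namespace AbQuandle

open Quandles

/-! ### Commutators along paths, and homomorphisms out of C₂/B₂ -/

section General

variable {X : Type*} [Rack X]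

theorem StructureGroup.induction {P : StructureGroup X → Prop} (one : P 1)
    (of : ∀ b, P (PresentedGroup.of b)) (inv : ∀ x, P x → P x⁻¹)
    (mul : ∀ x y, P x → P y → P (x * y)) (g : StructureGroup X) : P g := by
  obtain ⟨w, rfl⟩ := QuotientGroup.mk_surjective g
  induction w using FreeGroup.induction_on with
  | C1 => exact one
  | of b => exact of b
  | inv_of b _ => exact inv _ (of b)
  | mul x y hx hy => exact mul _ _ hx hy

theorem pathMap_of (a b : X) : pathMap a (PresentedGroup.of b) = edge a b := by
  simp [pathMap, walk, stepPerm]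

theorem endVertex_inv_endVertex (a : X) (g : StructureGroup X) :
    endVertex (endVertex a g⁻¹) g = a := by
  rw [← (walk_mul a g⁻¹ g).1, inv_mul_cancel, (pathMap_one a).1]

theorem pathMap_inv (a : X) (g : StructureGroup X) :
    pathMap a g⁻¹ = -pathMap (endVertex a g⁻¹) g := by
  have h := (walk_mul a g⁻¹ g).2
  rw [inv_mul_cancel, (pathMap_one a).2] at h
  exact eq_neg_of_add_eq_zero_left h.symm

/-- A function on vertices that is invariant under all translations is invariant under walks. -/
theorem invariant_endVertex {Y : Type*} (f : X → Y) (hf : ∀ a b : X, f (b ◃ a) = f a)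
    (g : StructureGroup X) : ∀ a, f (endVertex a g) = f a := by
  induction g using StructureGroup.induction with
  | one => intro a; rw [(pathMap_one a).1]
  | of b => intro a; rw [endVertex_of, hf]
  | inv x hx => intro a; rw [← hx (endVertex a x⁻¹), endVertex_inv_endVertex]
  | mul x y hx hy => intro a; rw [(walk_mul a x y).1, hy, hx]

/-- If the generators of the structure group commute up to `T` along paths, then so do all
elements. -/
theorem pathMap_mul_sub_mem (hX : IsAbelian X) (T : X → AddSubgroup (Q2 X))
    (hT : ∀ a b : X, T (b ◃ a) = T a)
    (h : ∀ a b c : X, (edge a b + edge (b ◃ a) c) - (edge a c + edge (c ◃ a) b) ∈ T a)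
    (g k : StructureGroup X) :
    ∀ a, pathMap a (g * k) - pathMap a (k * g) ∈ T a := by
  have symm : ∀ g k : StructureGroup X,
      (∀ a, pathMap a (g * k) - pathMap a (k * g) ∈ T a) →
      ∀ a, pathMap a (k * g) - pathMap a (g * k) ∈ T a := fun g k H a => by
    rw [← neg_sub]; exact neg_mem (H a)
  have step : ∀ k : StructureGroup X,
      (∀ b a, pathMap a (PresentedGroup.of b * k) - pathMap a (k * PresentedGroup.of b) ∈ T a) →
      ∀ g a, pathMap a (g * k) - pathMap a (k * g) ∈ T a := by
    intro k hk g
    induction g using StructureGroup.induction with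
    | one => intro a; simp
    | of b => exact hk b
    | inv x hx =>
      intro a
      -- Inverses are handled by moving the base point: the hypothesis for x at a · x⁻¹ is, up to
      -- sign, the claim for x⁻¹ at a.
      have h1 := hx (endVertex a x⁻¹)
      rw [invariant_endVertex T hT] at h1
      rw [(walk_mul _ x k).2, (walk_mul _ k x).2, endVertex_inv_endVertex] at h1
      rw [(walk_mul _ x⁻¹ k).2, (walk_mul _ k x⁻¹).2, pathMap_inv, pathMap_inv,
        endVertex_comm hX k x⁻¹]
      convert neg_mem h1 using 1
      abel
    | mul x y hx hy =>
      intro a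
      have h1 := hx a
      have h2 := hy (endVertex a x)
      rw [invariant_endVertex T hT] at h2
      rw [(walk_mul _ x k).2, (walk_mul _ k x).2] at h1
      rw [(walk_mul _ y k).2, (walk_mul _ k y).2] at h2
      rw [(walk_mul _ (x * y) k).2, (walk_mul _ x y).2, (walk_mul _ k (x * y)).2,
        (walk_mul _ x y).2, (walk_mul _ x y).1, endVertex_comm hX k x]
      convert add_mem h1 h2 using 1
      abel
  -- `step` reduces only the left factor to a generator, so it is used twice, with the roles
  -- exchanged by `symm` in between.
  refine step k (fun b => symm k _ (step _ (fun c a => ?_) k)) g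
  rw [(walk_mul _ _ _).2, (walk_mul _ _ _).2]
  simp only [pathMap_of, endVertex_of]
  exact h a c b

open scoped commutatorElement in
theorem pathMap_commutatorElement (hX : IsAbelian X) (a : X) (g k : StructureGroup X) :
    pathMap a ⁅g, k⁆ = pathMap a (g * k) - pathMap a (k * g) := by
  have h1 : ⁅g, k⁆ * (k * g) = g * k := by rw [commutatorElement_def]; group
  have h2 := (walk_mul a ⁅g, k⁆ (k * g)).2
  rw [h1, endVertex_of_mem_commutator hX
    (Subgroup.commutator_mem_commutator (Subgroup.mem_top _) (Subgroup.mem_top _))] at h2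
  rw [h2, add_sub_cancel_right]

-- Upper bound for the torsion group. The group elements that fix every vertex and have path values
-- in `T` form a subgroup, so it suffices to control commutators, and these reduce to pairs of
-- generators.
open scoped commutatorElement in
theorem torsionGroup_le (hX : IsAbelian X) (T : X → AddSubgroup (Q2 X))
    (hT : ∀ a b : X, T (b ◃ a) = T a)
    (h : ∀ a b c : X, (edge a b + edge (b ◃ a) c) - (edge a c + edge (c ◃ a) b) ∈ T a)
    (a : X) : torsionGroup a ≤ T a := by
  let S : Subgroup (StructureGroup X) :=
    { carrier := {g | ∀ a, endVertex a g = a ∧ pathMap a g ∈ T a}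
      one_mem' := fun a => ⟨(pathMap_one a).1, by rw [(pathMap_one a).2]; exact zero_mem _⟩
      mul_mem' := fun {x y} hx hy a => by
        rw [(walk_mul a x y).1, (walk_mul a x y).2, (hx a).1]
        exact ⟨(hy a).1, add_mem (hx a).2 (hy a).2⟩
      inv_mem' := fun {x} hx a => by
        have h1 : endVertex a x⁻¹ = a := by
          rw [← (hx (endVertex a x⁻¹)).1, endVertex_inv_endVertex]
        rw [pathMap_inv, h1]
        exact ⟨rfl, neg_mem (hx a).2⟩ }
  have hS : commutator (StructureGroup X) ≤ S := by
    rw [commutator_def, Subgroup.commutator_le]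
    intro x _ y _ a
    refine ⟨endVertex_of_mem_commutator hX
      (Subgroup.commutator_mem_commutator (Subgroup.mem_top _) (Subgroup.mem_top _)) a, ?_⟩
    rw [pathMap_commutatorElement hX]
    exact pathMap_mul_sub_mem hX T hT h x y a
  rintro _ ⟨g, hg, -, rfl⟩
  exact (hS hg a).2

-- The matching lower bound: this class is the value of the path map on the commutator of two
-- generators.
open scoped commutatorElement in
theorem sub_mem_torsionGroup (hX : IsAbelian X) (a b c : X) :
    (edge a b + edge (b ◃ a) c) - (edge a c + edge (c ◃ a) b) ∈ torsionGroup a := by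
  have hmem : ⁅(PresentedGroup.of b : StructureGroup X), PresentedGroup.of c⁆
      ∈ commutator (StructureGroup X) :=
    Subgroup.commutator_mem_commutator (Subgroup.mem_top _) (Subgroup.mem_top _)
  refine ⟨_, hmem, endVertex_of_mem_commutator hX hmem a, ?_⟩
  rw [pathMap_commutatorElement hX, (walk_mul _ _ _).2, (walk_mul _ _ _).2]
  simp only [pathMap_of, endVertex_of]

/-- The homomorphism on `Q₂` with prescribed values on edges. -/
noncomputable def Q2.lift {A : Type*} [AddCommGroup A] (f : X → X → A)
    (hf : ∀ a b c, f a b + f (b ◃ a) c = f a c + f (c ◃ a) (c ◃ b)) : Q2 X →+ A :=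
  QuotientAddGroup.lift (d3 X).range
    (Finsupp.liftAddHom fun p : X × X => zmultiplesHom A (f p.1 p.2)) (by
      rw [AddMonoidHom.range_le_ker_iff]
      refine Finsupp.addHom_ext' fun p => AddMonoidHom.ext_int ?_
      obtain ⟨a, b, c⟩ := p
      simp only [AddMonoidHom.comp_apply, Finsupp.singleAddHom_apply, d3_single, map_add, map_sub,
        Finsupp.liftAddHom_apply_single, zmultiplesHom_apply, one_smul, AddMonoidHom.zero_apply]
      rw [← sub_eq_zero.2 (hf a b c)]
      abel)

@[simp]
theorem Q2.lift_edge {A : Type*} [AddCommGroup A] (f : X → X → A) (hf) (a b : X) :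
    Q2.lift f hf (edge a b) = f a b := by
  change Finsupp.liftAddHom (fun p : X × X => zmultiplesHom A (f p.1 p.2))
    (Finsupp.single (a, b) 1) = _
  simp

theorem Q2.hom_ext {A : Type*} [AddCommGroup A] {φ ψ : Q2 X →+ A}
    (h : ∀ a b, φ (edge a b) = ψ (edge a b)) : φ = ψ := by
  refine QuotientAddGroup.addMonoidHom_ext _ (Finsupp.addHom_ext' fun p => AddMonoidHom.ext_int ?_)
  exact h p.1 p.2

theorem d2bar_edge (a b : X) :
    d2bar X (edge a b) = Finsupp.single (b ◃ a) 1 - Finsupp.single a 1 := d2_single X a b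

end General

/-! ### Parameters of U and the parameter group -/

section Parameters

variable {r : ℕ}

theorem FPMatrix.gen_of_val_eq_zero (M : FPMatrix r) {k : Fin r} (h : k.val = 0) :
    M.gen k = 0 := by
  simp [FPMatrix.gen, h]

/-- Additive maps out of `G(M)` are determined on the generators. -/
theorem FPMatrix.hom_ext {M : FPMatrix r} {A : Type*} [AddCommGroup A] {φ ψ : M.Grp →+ A}
    (h : ∀ k, φ (QuotientAddGroup.mk (Pi.single k 1)) = ψ (QuotientAddGroup.mk (Pi.single k 1))) :
    φ = ψ := by
  refine QuotientAddGroup.addMonoidHom_ext _ (AddMonoidHom.functions_ext' _ _ _ fun k => ?_)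
  exact AddMonoidHom.ext_int (h k)

variable (n : Fin r → ℕ)

theorem sub_val_ne_zero {i j : Fin r} (h : i ≠ j) : (j - i).val ≠ 0 := by
  intro h0
  have : NeZero r := ⟨by have := i.isLt; omega⟩
  have : j - i = 0 := Fin.ext h0
  exact h (sub_eq_zero.1 this).symm

variable {n} in
/-- If `M` are parameters of `U n`, each `G(M i)` is `ℤ / n i`, all generators being `1`. -/
theorem HasParameters.exists_equiv (hr : 2 ≤ r) {M : Fin r → FPMatrix r}
    (hM : HasParameters M (U n) U.index) (i : Fin r) :
    ∃ ψ : ZMod (n i) ≃+ (M i).Grp, ∀ k : Fin r, k.val ≠ 0 → (M i).gen k = ψ 1 := by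
  obtain ⟨e, he, hidx⟩ := hM
  have hex : ∀ a : ZMod (n i), ∃ y : (M i).Grp, e ⟨i, a⟩ = ⟨i, y⟩ := by
    intro a
    have h1 := hidx ⟨i, a⟩
    generalize e ⟨i, a⟩ = x at h1
    obtain ⟨i', y⟩ := x
    obtain rfl : i' = i := h1
    exact ⟨y, rfl⟩
  choose E hE using hex
  have hinj : Function.Injective E := by
    intro a b hab
    have h1 : e ⟨i, a⟩ = e ⟨i, b⟩ := by rw [hE, hE, hab]
    simpa using e.injective h1
  have hsurj : Function.Surjective E := by
    intro y
    obtain ⟨⟨i', a⟩, hx⟩ := e.surjective ⟨i, y⟩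
    have h1 := hidx ⟨i', a⟩
    rw [hx] at h1
    obtain rfl : i = i' := h1
    rw [hE] at hx
    exact ⟨a, by simpa using hx⟩
  have : NeZero r := ⟨by omega⟩
  have hstep : ∀ k : Fin r, k.val ≠ 0 → ∀ a, E (a + 1) = E a + (M i).gen k := by
    intro k hk a
    -- A vertex of orbit `i + k` translates orbit `i` by 1 in `U n` and by `gen k` in the
    -- parameters, which forces all `gen k` with k ≠ 0 to coincide.
    have hne : i ≠ i + k := by
      intro h
      have : k = 0 := by simpa using h
      exact hk (by simp [this])
    have h1 := he ⟨i, a⟩ ⟨i + k, 0⟩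
    have h2 : (⟨i + k, 0⟩ : U n) ◃ ⟨i, a⟩ = ⟨i, a + 1⟩ := by
      simp [Shelf.act, hne]
    have h3 : (e ⟨i + k, 0⟩) ◃ (⟨i, E a⟩ : FPQuandle M) = ⟨i, E a + (M i).gen k⟩ := by
      simp [Shelf.act, hidx]
    rw [h2, hE, hE, h3] at h1
    simpa using h1
  let k₁ : Fin r := ⟨1, by omega⟩
  have hk₁ : k₁.val ≠ 0 := one_ne_zero
  have hnat : ∀ m : ℕ, E m = E 0 + m • (M i).gen k₁ := by
    intro m
    induction m with
    | zero => simp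
    | succ m ih => rw [Nat.cast_succ, hstep k₁ hk₁, ih, succ_nsmul, add_assoc]
  have hzero : (n i : ℤ) • (M i).gen k₁ = 0 := by
    have := hnat (n i)
    simpa using this
  let ψ : ZMod (n i) →+ (M i).Grp :=
    ZMod.lift (n i) ⟨zmultiplesHom _ ((M i).gen k₁), by simpa using hzero⟩
  have hψ1 : ψ 1 = (M i).gen k₁ := by
    have := ZMod.lift_coe (n i) ⟨zmultiplesHom _ ((M i).gen k₁), by simpa using hzero⟩ 1
    simpa using this
  -- The quandle isomorphism need not send 0 to 0, so it is only affine on an orbit; subtracting `E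
  -- 0` makes it additive.
  have hψ : ∀ a, ψ a = E a - E 0 := by
    have hint : ∀ m : ℤ, E m = E 0 + m • (M i).gen k₁ := by
      intro m
      induction m using Int.induction_on with
      | zero => simp
      | succ m ih => rw [Int.cast_add, Int.cast_one, hstep k₁ hk₁, ih, add_zsmul, one_zsmul, add_assoc]
      | pred m ih =>
        have := hstep k₁ hk₁ ((-(m : ℤ) - 1 : ℤ) : ZMod (n i))
        rw [show (((-(m : ℤ) - 1 : ℤ) : ZMod (n i)) + 1) = ((-(m : ℤ) : ℤ) : ZMod (n i)) by simp, ih]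
          at this
        rw [eq_sub_of_add_eq this.symm, sub_zsmul, one_zsmul, ← sub_eq_add_neg, add_sub_assoc]
    intro a
    obtain ⟨m, rfl⟩ := ZMod.intCast_surjective a
    rw [hint, add_sub_cancel_left, ← hψ1, ← map_zsmul, zsmul_one]
  refine ⟨AddEquiv.ofBijective ψ ⟨fun a b hab => ?_, fun y => ?_⟩, fun k hk => ?_⟩
  · rw [hψ, hψ] at hab
    exact hinj (sub_left_injective hab)
  · obtain ⟨a, ha⟩ := hsurj (y + E 0)
    exact ⟨a, by rw [hψ, ha, add_sub_cancel_right]⟩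
  · change _ = ψ 1
    rw [hψ1]
    exact add_left_cancel ((hstep k hk 0).symm.trans (hstep k₁ hk₁ 0))

/-- The order `gcd (n₁, …, n_r, 2)` of the parameter group of `U n`. -/
abbrev torsionOrder : ℕ := Nat.gcd (Finset.univ.gcd n) 2

theorem torsionOrder_dvd (i : Fin r) : torsionOrder n ∣ n i :=
  (Nat.gcd_dvd_left _ _).trans (Finset.gcd_dvd (Finset.mem_univ i))

theorem torsionOrder_dvd_two : torsionOrder n ∣ 2 := Nat.gcd_dvd_right _ _

variable {n} in
theorem torsionOrder_nsmul_eq_zero {A : Type*} [AddCommGroup A] {x : A}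
    (h : ∀ i, n i • x = 0) (h2 : 2 • x = 0) : torsionOrder n • x = 0 := by
  rw [← addOrderOf_dvd_iff_nsmul_eq_zero] at h2 ⊢
  exact Nat.dvd_gcd (Finset.dvd_gcd fun i _ => addOrderOf_dvd_iff_nsmul_eq_zero.2 (h i)) h2

/-- The additive map `ℤ / m → A` sending `1` to an element killed by `m`. -/
def zmodHom {A : Type*} [AddCommGroup A] {m : ℕ} (x : A) (hx : m • x = 0) : ZMod m →+ A :=
  ZMod.lift m ⟨zmultiplesHom A x, by simpa using hx⟩

@[simp]
theorem zmodHom_intCast {A : Type*} [AddCommGroup A] {m : ℕ} (x : A) (hx : m • x = 0) (k : ℤ) :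
    zmodHom x hx k = k • x := by
  simp [zmodHom]

@[simp]
theorem zmodHom_natCast {A : Type*} [AddCommGroup A] {m : ℕ} (x : A) (hx : m • x = 0) (k : ℕ) :
    zmodHom x hx k = k • x := by
  rw [← Int.cast_natCast, zmodHom_intCast, natCast_zsmul]

@[simp]
theorem zmodHom_one {A : Type*} [AddCommGroup A] {m : ℕ} (x : A) (hx : m • x = 0) :
    zmodHom x hx 1 = x := by
  rw [← Nat.cast_one, zmodHom_natCast, one_smul]

theorem zmod_addMonoidHom_ext {A : Type*} [AddGroup A] {m : ℕ} {φ ψ : ZMod m →+ A}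
    (h : φ 1 = ψ 1) : φ = ψ := by
  ext a
  obtain ⟨k, rfl⟩ := ZMod.intCast_surjective a
  rw [← zsmul_one, map_zsmul, map_zsmul, h]

theorem exists_ne_ne (hr : 3 ≤ r) (i j : Fin r) : ∃ k, k ≠ i ∧ k ≠ j := by
  obtain ⟨k, hk⟩ := Finset.exists_mem_notMem_of_card_lt_card
    (s := {i, j}) (t := (Finset.univ : Finset (Fin r)))
    (lt_of_le_of_lt Finset.card_le_two (by simp; omega))
  exact ⟨k, by simpa using hk⟩

theorem nsmul_map_one {A : Type*} [AddMonoid A] {m : ℕ} (φ : ZMod m →+ A) : m • φ 1 = 0 := by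
  rw [← map_nsmul]
  simp

/-- A third index k gives c_i = -c_k = c_j; then c_i + c_k = 0 reads 2c_i = 0. -/
theorem eq_and_two_nsmul_eq_zero (hr : 3 ≤ r) {A : Type*} [AddCommGroup A] {c : Fin r → A}
    (hc : ∀ i j, i < j → c i + c j = 0) (i j : Fin r) : c i = c j ∧ 2 • c i = 0 := by
  have hc' : ∀ i j, i ≠ j → c i + c j = 0 := by
    intro i j hij
    rcases lt_or_gt_of_ne hij with h | h
    · exact hc i j h
    · rw [add_comm]; exact hc j i h
  have hceq : ∀ i j, c i = c j := by
    intro i j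
    obtain ⟨k, hki, hkj⟩ := exists_ne_ne hr i j
    exact add_right_cancel ((hc' i k hki.symm).trans (hc' j k hkj.symm).symm)
  refine ⟨hceq i j, ?_⟩
  obtain ⟨k, hk, -⟩ := exists_ne_ne hr i i
  rw [two_nsmul]
  nth_rewrite 2 [hceq i k]
  exact hc' _ _ hk.symm

-- The common class of the generators is killed by 2 and by all n_i, which gives the map from ℤ/d.
-- Conversely, reduce each factor ℤ/n_i modulo d and add up: each relator goes to 1 + 1, which
-- vanishes because d divides 2.
variable {n} in
theorem HasParameters.nonempty_parameterGroup_equiv (hr : 3 ≤ r) {M : Fin r → FPMatrix r}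
    (hM : HasParameters M (U n) U.index) :
    Nonempty (ParameterGroup M ≃+ ZMod (torsionOrder n)) := by
  choose ψ hψ using hM.exists_equiv (by omega)
  let mk : (∀ i : Fin r, (M i).Grp) →+ ParameterGroup M := QuotientAddGroup.mk' _
  let φ : ∀ i, ZMod (n i) →+ ParameterGroup M := fun i =>
    mk.comp ((AddMonoidHom.single _ i).comp (ψ i).toAddMonoidHom)
  have hc : ∀ i j, i < j → φ i 1 + φ j 1 = 0 := by
    intro i j hij
    change mk _ + mk _ = 0
    rw [← map_add]
    refine (QuotientAddGroup.eq_zero_iff _).2 (AddSubgroup.subset_closure ⟨i, j, hij, ?_⟩)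
    rw [hψ _ _ (sub_val_ne_zero hij.ne), hψ _ _ (sub_val_ne_zero hij.ne')]
    rfl
  let i₀ : Fin r := ⟨0, by omega⟩
  have hφ := fun i => (eq_and_two_nsmul_eq_zero hr hc i i₀).1
  have h2 : 2 • φ i₀ 1 = 0 := (eq_and_two_nsmul_eq_zero hr hc i₀ i₀).2
  have hn : ∀ i, n i • φ i₀ 1 = 0 := fun i => by
    rw [← hφ i]
    exact nsmul_map_one (φ i)
  let inv : ZMod (torsionOrder n) →+ ParameterGroup M :=
    zmodHom (φ i₀ 1) (torsionOrder_nsmul_eq_zero hn h2)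
  let red : ∀ i, (M i).Grp →+ ZMod (torsionOrder n) := fun i =>
    (ZMod.castHom (torsionOrder_dvd n i) (ZMod (torsionOrder n))).toAddMonoidHom.comp
      (ψ i).symm.toAddMonoidHom
  have hred : ∀ i, red i (ψ i 1) = 1 := by
    intro i
    change ZMod.castHom (torsionOrder_dvd n i) _ ((ψ i).symm (ψ i 1)) = 1
    rw [AddEquiv.symm_apply_apply, map_one]
  let sum : (∀ i : Fin r, (M i).Grp) →+ ZMod (torsionOrder n) :=
    ∑ i, (red i).comp (Pi.evalAddMonoidHom _ i)
  have hsum : ∀ i x, sum (Pi.single i x) = red i x := by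
    intro i x
    simp only [sum, AddMonoidHom.finsetSum_apply, AddMonoidHom.comp_apply,
      Pi.evalAddMonoidHom_apply]
    rw [Finset.sum_eq_single i]
    · simp
    · intro j _ hj; simp [Pi.single_eq_of_ne hj]
    · simp
  let fwd : ParameterGroup M →+ ZMod (torsionOrder n) := QuotientAddGroup.lift _ sum (by
    rw [AddSubgroup.closure_le]
    rintro _ ⟨i, j, hij, rfl⟩
    change sum _ = 0
    rw [hψ _ _ (sub_val_ne_zero hij.ne), hψ _ _ (sub_val_ne_zero hij.ne'), map_add, hsum, hsum,
      hred, hred, one_add_one_eq_two]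
    exact_mod_cast (ZMod.natCast_eq_zero_iff 2 _).2 (torsionOrder_dvd_two n))
  have hfc : ∀ i, fwd (φ i 1) = 1 := fun i => (hsum i _).trans (hred i)
  refine ⟨AddMonoidHom.toAddEquiv fwd inv ?_ ?_⟩
  · refine QuotientAddGroup.addMonoidHom_ext _
      (AddMonoidHom.functions_ext' (ParameterGroup M) _ _ fun i => ?_)
    have h : (inv.comp fwd).comp (φ i) = φ i := by
      refine zmod_addMonoidHom_ext ?_
      change inv (fwd (φ i 1)) = φ i 1
      rw [hfc]
      exact (zmodHom_one _ _).trans (hφ i).symm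
    refine AddMonoidHom.ext fun x => ?_
    obtain ⟨a, rfl⟩ := (ψ i).surjective x
    exact DFunLike.congr_fun h a
  · refine zmod_addMonoidHom_ext ?_
    change fwd (zmodHom (φ i₀ 1) (torsionOrder_nsmul_eq_zero hn h2) 1) = 1
    rw [zmodHom_one, hfc]

/-- The parameter matrix of `ℤ / m` with all generators equal to `1`. -/
def cyclicMatrix (r m : ℕ) (hm : 0 < m) : FPMatrix r where
  -- The first row says that m kills the first generator. Any later row means that its generator
  -- equals the first one; the coefficient m - 1 stands for -1, since entries below the diagonal
  -- must lie in [0, m).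
  m k l := if l = k then (if k.val = 0 then (m : ℤ) else 1)
    else if l.val = 0 then (m : ℤ) - 1 else 0
  upper i j hij := by
    have h1 : j ≠ i := hij.ne'
    have h2 : j.val ≠ 0 := by have : i.val < j.val := hij; omega
    simp [h1, h2]
  diag_pos i := by
    simp only [if_true]
    split_ifs <;> omega
  lower_nonneg i j _ := by
    split_ifs <;> omega
  lower_lt i j hij := by
    have h1 : j ≠ i := hij.ne'
    simp only [h1.symm, if_false, if_true]
    split_ifs <;> omega

theorem cyclicMatrix_equiv (hr : 2 ≤ r) (m : ℕ) (hm : 0 < m) :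
    ∃ φ : (cyclicMatrix r m hm).Grp ≃+ ZMod m,
      ∀ k : Fin r, k.val ≠ 0 → φ ((cyclicMatrix r m hm).gen k) = 1 := by
  set M := cyclicMatrix r m hm
  let k₀ : Fin (r - 1) := ⟨0, by omega⟩
  let x : Fin (r - 1) → M.Grp := fun k => QuotientAddGroup.mk (Pi.single k 1)
  have hrow : ∀ k, (QuotientAddGroup.mk (M.m k) : M.Grp) = 0 := fun k =>
    (QuotientAddGroup.eq_zero_iff _).2 (AddSubgroup.subset_closure ⟨k, rfl⟩)
  have hsm : ∀ (z : ℤ) k, z • x k = QuotientAddGroup.mk (Pi.single k z) := by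
    intro z k
    change QuotientAddGroup.mk (z • Pi.single k 1) = _
    rw [← Pi.single_smul, smul_eq_mul, mul_one]
  have hm0 : m • x k₀ = 0 := by
    rw [← natCast_zsmul, hsm, ← hrow k₀]
    congr 1
    ext l
    by_cases h : l = k₀
    · subst h; simp [M, cyclicMatrix, k₀]
    · have : l.val ≠ 0 := fun h0 => h (Fin.ext h0)
      simp [M, cyclicMatrix, h, this]
  have hx : ∀ k, x k = x k₀ := by
    intro k
    by_cases hk : k = k₀
    · rw [hk]
    have hk0 : k.val ≠ 0 := fun h0 => hk (Fin.ext h0)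
    have h1 : ((m : ℤ) - 1) • x k₀ + x k = 0 := by
      rw [← one_smul ℤ (x k), hsm, hsm, ← QuotientAddGroup.mk_add, ← hrow k]
      congr 1
      ext l
      by_cases h : l = k
      · subst h; simp [M, cyclicMatrix, hk0, hk]
      · by_cases h0 : l = k₀
        · subst h0; simp [M, cyclicMatrix, h, k₀]
        · have : l.val ≠ 0 := fun h' => h0 (Fin.ext h')
          simp [M, cyclicMatrix, h, h0, this]
    rw [sub_smul, one_smul, natCast_zsmul, hm0, zero_sub] at h1
    exact (neg_add_eq_zero.1 h1).symm
  let sum : (Fin (r - 1) → ℤ) →+ ZMod m :=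
    (Int.castAddHom (ZMod m)).comp (∑ k, Pi.evalAddMonoidHom _ k)
  have hsum : ∀ v, sum v = ((∑ k, v k : ℤ) : ZMod m) := by
    intro v
    simp [sum]
  let fwd : M.Grp →+ ZMod m := QuotientAddGroup.lift _ sum (by
    rw [AddSubgroup.closure_le]
    rintro _ ⟨k, rfl⟩
    change sum _ = 0
    rw [hsum]
    by_cases hk : k = k₀
    · rw [Finset.sum_eq_single k₀]
      · subst hk; simp [M, cyclicMatrix, k₀]
      · intro l _ hl
        have : l.val ≠ 0 := fun h' => hl (Fin.ext h')
        simp [M, cyclicMatrix, hk, hl, this]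
      · simp
    · have hk0 : k.val ≠ 0 := fun h0 => hk (Fin.ext h0)
      rw [Finset.sum_eq_add_of_mem k k₀ (Finset.mem_univ _) (Finset.mem_univ _) hk]
      · have : k₀ ≠ k := fun h => hk h.symm
        simp [M, cyclicMatrix, hk0, this, k₀]
      · rintro l - ⟨h1, h2⟩
        have : l.val ≠ 0 := fun h' => h2 (Fin.ext h')
        simp [M, cyclicMatrix, h1, this])
  have hfx : ∀ k, fwd (x k) = 1 := by
    intro k
    refine (hsum _).trans ?_
    simp
  refine ⟨AddMonoidHom.toAddEquiv fwd (zmodHom (x k₀) hm0) ?_ ?_, ?_⟩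
  · refine FPMatrix.hom_ext fun k => ?_
    change zmodHom (x k₀) hm0 (fwd (x k)) = x k
    rw [hfx, zmodHom_one, ← hx k]
  · refine zmod_addMonoidHom_ext ?_
    change fwd (zmodHom (x k₀) hm0 1) = 1
    rw [zmodHom_one, hfx]
  · intro k hk
    change fwd (M.gen k) = 1
    rw [FPMatrix.gen, dif_neg hk]
    exact hfx _

theorem exists_hasParameters (hr : 2 ≤ r) (hn : ∀ i, 0 < n i) :
    ∃ M : Fin r → FPMatrix r, HasParameters M (U n) U.index := by
  choose φ hφ using fun i => cyclicMatrix_equiv hr (n i) (hn i)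
  refine ⟨fun i => cyclicMatrix r (n i) (hn i),
    ⟨fun a => ⟨a.index, (φ a.index).symm a.val⟩, fun b => ⟨b.index, φ b.index b.val⟩,
      fun a => by simp, fun b => by simp⟩, ?_, fun _ => rfl⟩
  rintro ⟨i, a⟩ ⟨j, b⟩
  by_cases h : i = j
  · subst h
    have h0 : (i - i).val = 0 := by
      have : NeZero r := ⟨by omega⟩
      simp
    simp [Shelf.act, FPMatrix.gen_of_val_eq_zero _ h0]
  · have h1 := hφ i (j - i) (sub_val_ne_zero h)
    simp [Shelf.act, h, AddEquiv.symm_apply_eq, h1]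

end Parameters

/-! ### Relations between edges of U, and the torsion class of an orbit -/

section EdgesU

variable {r : ℕ} {n : Fin r → ℕ}

namespace U

/-- The vertex `a + 1` of the orbit of `a`. -/
def succ (a : U n) : U n := ⟨a.index, a.val + 1⟩

/-- The residue of a natural number in the `i`-th orbit. -/
def pt (n : Fin r → ℕ) (i : Fin r) (m : ℕ) : U n := ⟨i, m⟩

theorem act_def (a b : U n) : b ◃ a = if a.index = b.index then a else succ a := by
  by_cases h : a.index = b.index <;> simp [Shelf.act, h, succ]

theorem act_of_eq {a b : U n} (h : a.index = b.index) : b ◃ a = a := by rw [act_def, if_pos h]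

theorem act_of_ne {a b : U n} (h : a.index ≠ b.index) : b ◃ a = succ a := by rw [act_def, if_neg h]

@[simp] theorem index_succ (a : U n) : (succ a).index = a.index := rfl

@[simp] theorem index_act (a b : U n) : (b ◃ a).index = a.index := rfl

@[simp] theorem index_pt (i : Fin r) (m : ℕ) : (pt n i m).index = i := rfl

theorem succ_pt (i : Fin r) (m : ℕ) : succ (pt n i m) = pt n i (m + 1) := by
  unfold succ pt
  rw [Nat.cast_succ]

theorem pt_self (i : Fin r) : pt n i (n i) = pt n i 0 := by
  simp [pt]

theorem succ_injective : Function.Injective (succ (n := n)) := by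
  rintro ⟨i, a⟩ ⟨j, b⟩ h
  obtain rfl : i = j := congrArg U.index h
  simpa [succ] using h

theorem exists_eq_pt (hn : ∀ i, 0 < n i) (a : U n) : ∃ m, a = pt n a.index m := by
  have : NeZero (n a.index) := ⟨(hn _).ne'⟩
  obtain ⟨m, hm⟩ := ZMod.natCast_zmod_surjective a.val
  exact ⟨m, by rw [pt, hm]⟩

end U

open U

/-- This and the next three lemmas run through the coincidence patterns of the orbits of a, b, c;
when all three agree, the square is trivial. -/
theorem edge_square_eq_ne {a b c : U n} (h : b.index = a.index) (h' : c.index ≠ a.index) :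
    edge a b = edge (succ a) (succ b) := by
  have := edge_square a b c
  rw [act_of_eq h.symm, act_of_ne h'.symm, act_of_ne (h.trans_ne h'.symm), add_comm] at this
  exact add_left_cancel this

theorem edge_square_ne_eq {a b c : U n} (h : b.index ≠ a.index) (h' : c.index = a.index) :
    edge a b + edge (succ a) c = edge a c + edge a (succ b) := by
  have := edge_square a b c
  rwa [act_of_ne h.symm, act_of_eq h'.symm, act_of_ne (h.trans_eq h'.symm)] at this

theorem edge_square_same {a b c : U n} (h : b.index ≠ a.index) (h' : c.index = b.index) :
    edge a b + edge (succ a) c = edge a c + edge (succ a) b := by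
  have := edge_square a b c
  rwa [act_of_ne h.symm, act_of_ne (h'.trans_ne h).symm, act_of_eq h'.symm] at this

theorem edge_square_distinct {a b c : U n} (h : b.index ≠ a.index) (h' : c.index ≠ a.index)
    (h'' : b.index ≠ c.index) :
    edge a b + edge (succ a) c = edge a c + edge (succ a) (succ b) := by
  have := edge_square a b c
  rwa [act_of_ne h.symm, act_of_ne h'.symm, act_of_ne h''] at this

/-- The torsion class `(a, b + 1) - (a, b)` attached to the `i`-th orbit, for `a = 0` in this orbit
and `b = 0` in the orbit `β i`. -/
noncomputable def tau (n : Fin r → ℕ) (β : Fin r → Fin r) (i : Fin r) : Q2 (U n) :=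
  edge (pt n i 0) (pt n (β i) 1) - edge (pt n i 0) (pt n (β i) 0)

variable {β : Fin r → Fin r} (hβ : ∀ i, β i ≠ i)

-- In the square with b outside and c inside the orbit of a, the increment in b equals the increment
-- in a of the edge to c, so neither depends on the choice of b or c. The square with both labels in
-- the orbit `β i` shows that it does not depend on a either.
include hβ in
theorem edge_succ_right_and_left (hn : ∀ i, 0 < n i) {a b c : U n} (h : b.index ≠ a.index)
    (h' : c.index = a.index) : edge a (succ b) = edge a b + tau n β a.index ∧
      edge (succ a) c = edge a c + tau n β a.index := by
  have key : ∀ {a b b' : U n}, b.index ≠ a.index → b'.index ≠ a.index →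
      edge a (succ b) - edge a b = edge a (succ b') - edge a b' := by
    intro a b b' h h'
    have h1 := edge_square_ne_eq h (rfl : a.index = a.index)
    have h2 := edge_square_ne_eq h' (rfl : a.index = a.index)
    rw [← sub_eq_sub_iff_add_eq_add] at h1 h2
    rw [← neg_sub, ← neg_sub (edge a b'), neg_inj]
    have e1 : edge a b - edge a (succ b) = edge a a - edge (succ a) a := by rw [h1]
    have e2 : edge a b' - edge a (succ b') = edge a a - edge (succ a) a := by rw [h2]
    rw [e1, e2]
  have base : ∀ {a b : U n}, b.index ≠ a.index →
      edge a (succ b) - edge a b = tau n β a.index := by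
    intro a b h
    obtain ⟨m, hm⟩ := exists_eq_pt hn a
    rw [key (b' := pt n (β a.index) 0) h (hβ _), succ_pt]
    generalize a.index = i at hm
    subst hm
    induction m with
    | zero => rfl
    | succ m ih =>
      rw [← ih h, ← succ_pt]
      -- This square compares the increment at vertex m with the one at m + 1.
      have h1 := edge_square_same (a := pt n i m) (b := pt n (β i) 1) (c := pt n (β i) 0)
        (hβ _) rfl
      rw [← sub_eq_zero] at h1 ⊢
      rw [← neg_eq_zero, ← h1]
      abel
  have h1 := base h
  refine ⟨by rw [← h1]; abel, ?_⟩
  rw [← h1]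
  have h2 := edge_square_ne_eq h h'
  rw [add_sub, ← h2]
  abel

section Relations

include hβ

theorem edge_succ_right (hn : ∀ i, 0 < n i) {a b : U n} (h : b.index ≠ a.index) :
    edge a (succ b) = edge a b + tau n β a.index :=
  (edge_succ_right_and_left hβ hn h rfl).1

theorem edge_succ_left (hn : ∀ i, 0 < n i) {a c : U n} (h : c.index = a.index) :
    edge (succ a) c = edge a c + tau n β a.index :=
  (edge_succ_right_and_left hβ hn (b := pt n (β a.index) 0) (hβ _) h).2

theorem edge_pt_right (hn : ∀ i, 0 < n i) {a : U n} {j : Fin r} (h : j ≠ a.index) (m : ℕ) :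
    edge a (pt n j m) = edge a (pt n j 0) + m • tau n β a.index := by
  induction m with
  | zero => simp
  | succ m ih => rw [← succ_pt, edge_succ_right hβ hn (by exact h), ih, succ_nsmul, add_assoc]

theorem edge_pt_left (hn : ∀ i, 0 < n i) {c : U n} (m : ℕ) :
    edge (pt n c.index m) c = edge (pt n c.index 0) c + m • tau n β c.index := by
  induction m with
  | zero => simp
  | succ m ih => rw [← succ_pt, edge_succ_left hβ hn (a := pt n c.index m) (c := c) rfl, ih, succ_nsmul,
      add_assoc, index_pt]

/-- A full turn around orbit j adds n_j copies of `tau` and returns to the same edge. The turn is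
made in the label if j ≠ i, and in the source of an edge inside the orbit if j = i. -/
theorem nsmul_tau (hn : ∀ i, 0 < n i) (i j : Fin r) : n j • tau n β i = 0 := by
  by_cases h : j = i
  · subst h
    have := edge_pt_left hβ hn (c := pt n j 0) (n j)
    rw [index_pt, pt_self] at this
    exact (left_eq_add.1 this)
  · have := edge_pt_right hβ hn (a := pt n i 0) h (n j)
    rw [pt_self] at this
    exact (left_eq_add.1 this)

/-- Inside an orbit an edge is unchanged by shifting both ends, so shifting the label alone has the
opposite effect of shifting the source. -/
theorem edge_pt_pt_same (hn : ∀ i, 0 < n i) (i : Fin r) (m : ℕ) :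
    edge (pt n i 0) (pt n i m) = edge (pt n i 0) (pt n i 0) - m • tau n β i := by
  induction m with
  | zero => simp
  | succ m ih =>
    have h1 := edge_square_eq_ne (a := pt n i 0) (b := pt n i m) (c := pt n (β i) 0) rfl (hβ i)
    rw [edge_succ_left hβ hn (a := pt n i 0) (c := succ (pt n i m)) rfl, ih, index_pt,
      succ_pt] at h1
    rw [eq_sub_of_add_eq h1.symm, succ_nsmul, sub_sub]

theorem edge_succ_left_distinct (hn : ∀ i, 0 < n i) {a b c : U n} (h : b.index ≠ a.index)
    (h' : c.index ≠ a.index) (h'' : b.index ≠ c.index) :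
    edge (succ a) c - edge a c = edge (succ a) b - edge a b + tau n β a.index := by
  have h1 := edge_square_distinct h h' h''
  rw [edge_succ_right hβ hn (by exact h), index_succ] at h1
  rw [← sub_eq_zero] at h1 ⊢
  rw [← h1]
  abel

/-- The comparison of increments `edge_succ_left_distinct` is not symmetric in the two target
orbits; applying it in both orders adds `tau` twice and returns to the start. -/
theorem two_nsmul_tau (hr : 3 ≤ r) (hn : ∀ i, 0 < n i) (i : Fin r) : 2 • tau n β i = 0 := by
  obtain ⟨k, hk, hk'⟩ := exists_ne_ne hr i (β i)
  have h1 := edge_succ_left_distinct hβ hn (a := pt n i 0) (b := pt n k 0) (c := pt n (β i) 0)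
    hk (hβ i) hk'
  have h2 := edge_succ_left_distinct hβ hn (a := pt n i 0) (c := pt n k 0) (b := pt n (β i) 0)
    (hβ i) hk hk'.symm
  rw [h2, add_assoc] at h1
  rw [two_nsmul]
  exact left_eq_add.1 h1

/-- With three orbits `β i`, k, l besides i, going from `β i` to l directly adds `tau` once, and
going through k adds it twice. -/
theorem tau_eq_zero (hr : 4 ≤ r) (hn : ∀ i, 0 < n i) (i : Fin r) : tau n β i = 0 := by
  obtain ⟨k, hk, hk'⟩ := exists_ne_ne (by omega) i (β i)
  obtain ⟨l, hl⟩ := Finset.exists_mem_notMem_of_card_lt_card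
    (s := {i, β i, k}) (t := (Finset.univ : Finset (Fin r)))
    (lt_of_le_of_lt Finset.card_le_three (by simp; omega))
  simp only [Finset.mem_univ, Finset.mem_insert, Finset.mem_singleton, not_or, true_and] at hl
  have h1 := edge_succ_left_distinct hβ hn (a := pt n i 0) (b := pt n (β i) 0) (c := pt n k 0)
    (hβ i) hk hk'.symm
  have h2 := edge_succ_left_distinct hβ hn (a := pt n i 0) (b := pt n k 0) (c := pt n l 0)
    hk hl.1 (Ne.symm hl.2.2)
  have h3 := edge_succ_left_distinct hβ hn (a := pt n i 0) (b := pt n (β i) 0) (c := pt n l 0)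
    (hβ i) hl.1 (Ne.symm hl.2.1)
  rw [h3, h1] at h2
  exact left_eq_add.1 h2

theorem edge_pt_left_distinct (hn : ∀ i, 0 < n i) {i j : Fin r} (h : j ≠ i) (h' : j ≠ β i)
    (m : ℕ) : edge (pt n i m) (pt n j 0) = edge (pt n i m) (pt n (β i) 0) +
      (edge (pt n i 0) (pt n j 0) - edge (pt n i 0) (pt n (β i) 0)) + m • tau n β i := by
  induction m with
  | zero => simp
  | succ m ih =>
    have h1 := edge_succ_left_distinct hβ hn (a := pt n i m) (b := pt n (β i) 0) (c := pt n j 0)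
      (hβ i) h h'.symm
    rw [sub_eq_iff_eq_add, ih, succ_pt, index_pt] at h1
    rw [h1, succ_nsmul]
    abel

end Relations

/-- The torsion group of an orbit is generated by `tau`. -/
theorem torsionGroup_eq_zmultiples (hβ : ∀ i, β i ≠ i) (hn : ∀ i, 0 < n i) (a : U n) :
    torsionGroup a = AddSubgroup.zmultiples (tau n β a.index) := by
  refine le_antisymm ?_ ?_
  · refine torsionGroup_le (isAbelian_U n) (fun a => AddSubgroup.zmultiples (tau n β a.index))
      (fun _ _ => rfl) (fun a b c => ?_) a
    -- The square turns the commutator value into the effect of c acting on the label b, with source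
    -- c ◃ a. It is 0, -τ or τ according to whether b and c, or else a and b, share an orbit.
    rw [edge_square]
    by_cases hbc : b.index = c.index
    · rw [act_of_eq hbc, sub_self]; exact zero_mem _
    rw [act_of_ne hbc, add_sub_add_left_eq_sub]
    by_cases hab : a.index = b.index
    · rw [act_of_ne (hab.trans_ne hbc),
        ← edge_square_eq_ne hab.symm (c := c) (fun h => hbc (hab.symm.trans h.symm)),
        edge_succ_left hβ hn hab.symm, sub_add_cancel_left]
      exact neg_mem (AddSubgroup.mem_zmultiples _)
    · rw [edge_succ_right hβ hn (by exact Ne.symm hab), add_sub_cancel_left]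
      exact AddSubgroup.mem_zmultiples _
  · rw [AddSubgroup.zmultiples_le]
    -- Taking the generator of a itself as the second factor leaves a fixed and shifts the label in
    -- `β i`, which gives exactly `tau`.
    have h := sub_mem_torsionGroup (isAbelian_U n) a (pt n (β a.index) 0) a
    rwa [edge_square, act_of_eq rfl, act_of_ne (hβ _), add_sub_add_left_eq_sub,
      edge_succ_right hβ hn (hβ _), add_sub_cancel_left] at h

end EdgesU

/-! ### Coordinates on chains and the computation of H₂ -/

section HomologyU

variable {r : ℕ} {n : Fin r → ℕ}

open U

/-- Counts the edges of a chain from the `i`-th orbit with label in the `j`-th orbit. -/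
noncomputable def edgeCount (n : Fin r → ℕ) (i j : Fin r) : Q2 (U n) →+ ℤ :=
  Q2.lift (fun a b => if a.index = i ∧ b.index = j then 1 else 0) fun a b c => by
    simp only [index_act]
    ring

@[simp]
theorem edgeCount_edge (i j : Fin r) (a b : U n) :
    edgeCount n i j (edge a b) = if a.index = i ∧ b.index = j then 1 else 0 :=
  Q2.lift_edge _ _ _ _

/-- Records the initial vertices of the edges whose label lies in another orbit. -/
noncomputable def sources (n : Fin r → ℕ) : Q2 (U n) →+ (U n →₀ ℤ) :=
  Q2.lift (fun a b => if a.index = b.index then 0 else Finsupp.single a 1) fun a b c => by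
    simp only [index_act]
    by_cases h : a.index = b.index <;> by_cases h' : a.index = c.index <;>
      simp [act_def, h, h', add_comm]

@[simp]
theorem sources_edge (a b : U n) :
    sources n (edge a b) = if a.index = b.index then 0 else Finsupp.single a 1 :=
  Q2.lift_edge _ _ _ _

/-- An edge within an orbit is a loop, and every other edge from a ends at a + 1 whatever its label.
-/
theorem d2bar_eq_sources (x : Q2 (U n)) :
    d2bar (U n) x = (sources n x).mapDomain succ - sources n x := by
  have : d2bar (U n)
      = (Finsupp.mapDomain.addMonoidHom succ).comp (sources n) - sources n := by
    refine Q2.hom_ext fun a b => ?_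
    by_cases h : a.index = b.index <;>
      simp [d2bar_edge, act_def, h, Finsupp.mapDomain.addMonoidHom, Finsupp.mapDomain_single]
  exact DFunLike.congr_fun this x

theorem sources_pt_of_mem_H2 {x : Q2 (U n)} (hx : x ∈ H2 (U n)) (i : Fin r) (m : ℕ) :
    sources n x (pt n i m) = sources n x (pt n i 0) := by
  have h : (sources n x).mapDomain succ = sources n x := by
    rw [← sub_eq_zero, ← d2bar_eq_sources]
    exact hx
  induction m with
  | zero => rfl
  | succ m ih => rw [← ih, ← succ_pt, ← Finsupp.mapDomain_apply succ_injective _ (pt n i m), h]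

/-- The residue modulo `d` of the position of a vertex in its orbit. -/
def residue {d : ℕ} (hd : ∀ i, d ∣ n i) (a : U n) : ZMod d :=
  ZMod.castHom (hd a.index) (ZMod d) a.val

@[simp]
theorem residue_succ {d : ℕ} (hd : ∀ i, d ∣ n i) (a : U n) :
    residue hd (succ a) = residue hd a + 1 := by
  rw [residue, succ, map_add, map_one, residue]

@[simp]
theorem residue_pt {d : ℕ} (hd : ∀ i, d ∣ n i) (i : Fin r) (m : ℕ) :
    residue hd (pt n i m) = m := by
  rw [residue, pt, map_natCast]

theorem zmod_two_eq_zero {d : ℕ} (hd : d ∣ 2) : (2 : ZMod d) = 0 := by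
  exact_mod_cast (ZMod.natCast_eq_zero_iff 2 d).2 hd

/-- The functional on chains detecting the torsion class of the `i`-th orbit. -/
noncomputable def torsionCoord {d : ℕ} (hd : ∀ i, d ∣ n i) (hd2 : d ∣ 2) (hr : d = 1 ∨ r = 3)
    {β : Fin r → Fin r} (hβ : ∀ i, β i ≠ i) (i : Fin r) : Q2 (U n) →+ ZMod d :=
  Q2.lift (fun a b => if a.index = i then
      if b.index = i then residue hd a - residue hd b
      else if b.index = β i then residue hd b else residue hd a + residue hd b
    else 0) fun a b c => by
    rcases hr with rfl | hr
    · exact Subsingleton.elim _ _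
    have h2 := zmod_two_eq_zero hd2
    -- With three orbits, only one differs from both i and `β i`, so two distinct labels outside
    -- orbit i always include one in `β i`.
    have h3 : ∀ j k : Fin r, j ≠ i → k ≠ i → j ≠ β i → k ≠ β i → j = k := by
      intro j k h1 h2 h3 h4
      have := hβ i
      subst hr
      omega
    have h4 := hβ i
    by_cases hai : a.index = i
    · by_cases hbi : b.index = i <;> by_cases hci : c.index = i
      · simp [act_def, hai, hbi, hci]
        ring
      · by_cases hc : c.index = β i
        · simp [act_def, hai, hbi, hc, h4, h4.symm]
          ring
        · simp [act_def, hai, hbi, hci, Ne.symm hci, hc]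
          ring
      · by_cases hb : b.index = β i
        · simp [act_def, hai, hb, hci, h4, h4.symm]
          ring
        · simp [act_def, hai, hbi, hci, Ne.symm hbi, hb]
          ring
      · by_cases hbc : b.index = c.index
        · by_cases hc : c.index = β i
          · simp [act_def, hai, hbc, hc, h4, h4.symm]
            ring
          · simp [act_def, hai, hbc, hci, Ne.symm hci, hc]
            ring
        · by_cases hb : b.index = β i
          · have hc : c.index ≠ β i := fun h => hbc (hb.trans h.symm)
            simp [act_def, hai, hb, hc, hci, Ne.symm hci, Ne.symm hc, h4, h4.symm]
            ring
          · have hc : c.index = β i := by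
              by_contra hc
              exact hbc (h3 _ _ hbi hci hb hc)
            simp [act_def, hai, hb, hc, hbi, Ne.symm hbi, h4, h4.symm]
            -- The two sides differ by 2; this is the only pattern that needs d to divide 2.
            linear_combination -h2
    · simp [hai]

@[simp]
theorem torsionCoord_edge {d : ℕ} (hd : ∀ i, d ∣ n i) (hd2 : d ∣ 2) (hr : d = 1 ∨ r = 3)
    {β : Fin r → Fin r} (hβ : ∀ i, β i ≠ i) (i : Fin r) (a b : U n) :
    torsionCoord hd hd2 hr hβ i (edge a b) = if a.index = i then
      if b.index = i then residue hd a - residue hd b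
      else if b.index = β i then residue hd b else residue hd a + residue hd b
    else 0 := Q2.lift_edge _ _ _ _

theorem torsionCoord_tau {d : ℕ} (hd : ∀ i, d ∣ n i) (hd2 : d ∣ 2) (hr : d = 1 ∨ r = 3)
    {β : Fin r → Fin r} (hβ : ∀ i, β i ≠ i) (i j : Fin r) :
    torsionCoord hd hd2 hr hβ i (tau n β j) = if j = i then 1 else 0 := by
  by_cases h : j = i
  · subst h; simp [tau, hβ]
  · simp [tau, h]

/-- The relations make ℤ/d map onto the torsion group, and `torsionCoord` is a left inverse of this
map, so no further collapse occurs. -/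
theorem torsionGroup_equiv {d : ℕ} (hd : ∀ i, d ∣ n i) (hd2 : d ∣ 2) (hr : d = 1 ∨ r = 3)
    {β : Fin r → Fin r} (hβ : ∀ i, β i ≠ i) (hn : ∀ i, 0 < n i)
    (hτ : ∀ i, d • tau n β i = 0) (a : U n) : Nonempty (ZMod d ≃+ torsionGroup a) := by
  have hinj : Function.Injective (zmodHom _ (hτ a.index)) := by
    refine Function.LeftInverse.injective (g := torsionCoord hd hd2 hr hβ a.index) fun s => ?_
    obtain ⟨k, rfl⟩ := ZMod.intCast_surjective s
    rw [zmodHom_intCast, map_zsmul, torsionCoord_tau, if_pos rfl, zsmul_one]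
  have hrange : (zmodHom _ (hτ a.index)).range = torsionGroup a := by
    rw [torsionGroup_eq_zmultiples hβ hn]
    ext x
    rw [AddSubgroup.mem_zmultiples_iff, AddMonoidHom.mem_range]
    constructor
    · rintro ⟨s, rfl⟩
      obtain ⟨k, rfl⟩ := ZMod.intCast_surjective s
      exact ⟨k, (zmodHom_intCast _ _ _).symm⟩
    · rintro ⟨k, rfl⟩
      exact ⟨k, zmodHom_intCast _ _ _⟩
  exact ⟨(AddMonoidHom.ofInjective hinj).trans (AddEquiv.addSubgroupCongr hrange)⟩

/-- The chain obtained by leaving each vertex of a 0-chain towards the orbit selected by `β`. -/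
noncomputable def leave (n : Fin r → ℕ) (β : Fin r → Fin r) : (U n →₀ ℤ) →+ Q2 (U n) :=
  Finsupp.liftAddHom fun v => zmultiplesHom (Q2 (U n)) (edge v (pt n (β v.index) 0))

@[simp]
theorem leave_single (β : Fin r → Fin r) (v : U n) :
    leave n β (Finsupp.single v 1) = edge v (pt n (β v.index) 0) := by
  simp [leave]

/-- For `j = i` the loop `(0, 0)`, for `j ≠ i` the difference of the edges leaving `0` towards the
orbits `j` and `β i`. -/
noncomputable def loopClass (n : Fin r → ℕ) (β : Fin r → Fin r) (i j : Fin r) : Q2 (U n) :=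
  edge (pt n i 0) (pt n j 0) - if j = i then 0 else edge (pt n i 0) (pt n (β i) 0)

/-- It suffices to treat one edge (k, l) from O_i to O_j. If j = i it is (0, 0) + (k - l)τ_i.
Otherwise moving l to 0 costs lτ_i, and if j ≠ β i, redirecting the edge to `β i` costs a
`loopClass` and kτ_i. The three branches of `torsionCoord` are these coefficients. -/
theorem chain_normal_form (hn : ∀ i, 0 < n i) {d : ℕ} (hd : ∀ i, d ∣ n i) (hd2 : d ∣ 2)
    (hr : d = 1 ∨ r = 3) {β : Fin r → Fin r} (hβ : ∀ i, β i ≠ i) (hτ : ∀ i, d • tau n β i = 0)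
    (x : Q2 (U n)) :
    x = leave n β (sources n x) + ∑ i, zmodHom _ (hτ i) (torsionCoord hd hd2 hr hβ i x)
      + ∑ i, ∑ j, edgeCount n i j x • loopClass n β i j := by
  have : AddMonoidHom.id (Q2 (U n)) = (leave n β).comp (sources n)
      + ∑ i, (zmodHom _ (hτ i)).comp (torsionCoord hd hd2 hr hβ i)
      + ∑ i, ∑ j, ((zmultiplesHom _ (loopClass n β i j)).comp (edgeCount n i j)) := by
    refine Q2.hom_ext fun a b => ?_
    obtain ⟨i, hi⟩ : ∃ i, a.index = i := ⟨_, rfl⟩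
    obtain ⟨j, hj⟩ : ∃ j, b.index = j := ⟨_, rfl⟩
    obtain ⟨k, ha⟩ := exists_eq_pt hn a
    obtain ⟨l, hb⟩ := exists_eq_pt hn b
    rw [hi] at ha
    rw [hj] at hb
    subst ha hb
    simp only [AddMonoidHom.add_apply, AddMonoidHom.finsetSum_apply, AddMonoidHom.comp_apply,
      AddMonoidHom.id_apply]
    rw [Finset.sum_eq_single i (by intro k _ hk; simp [hk.symm]) (by simp),
      Finset.sum_eq_single i (by intro k _ hk; simp [hk.symm]) (by simp),
      Finset.sum_eq_single j (by intro k _ hk; simp [hk.symm]) (by simp)]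
    by_cases h : j = i
    · subst h
      have h1 := edge_pt_left hβ hn (c := pt n j l) k
      rw [index_pt, edge_pt_pt_same hβ hn] at h1
      simp only [sources_edge, torsionCoord_edge, edgeCount_edge, index_pt, loopClass, if_true,
        residue_pt, map_zero, map_sub, zmodHom_natCast, and_self, zmultiplesHom_apply, one_smul,
        sub_zero]
      rw [h1]
      abel
    · have h1 : edge (pt n i k) (pt n j l) = edge (pt n i k) (pt n j 0) + l • tau n β i :=
        edge_pt_right hβ hn h l
      have h2 : sources n (edge (pt n i k) (pt n j l)) = Finsupp.single (pt n i k) 1 := by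
        rw [sources_edge, if_neg (by exact Ne.symm h)]
      simp only [h2, torsionCoord_edge, edgeCount_edge, index_pt, loopClass, if_true, residue_pt,
        and_self, zmultiplesHom_apply, one_smul, if_neg h, leave_single]
      rw [h1]
      by_cases hj : j = β i
      · subst hj
        simp only [if_true, zmodHom_natCast, sub_self, add_zero]
      · rw [edge_pt_left_distinct hβ hn h hj, if_neg hj, map_add, zmodHom_natCast,
          zmodHom_natCast]
        abel
  simpa using DFunLike.congr_fun this x

/-- The coordinates of a 2-cycle: one integer for each ordered pair of orbits, and one torsion
coordinate for each orbit. -/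
noncomputable def cycleCoord {d : ℕ} (hd : ∀ i, d ∣ n i) (hd2 : d ∣ 2) (hr : d = 1 ∨ r = 3)
    {β : Fin r → Fin r} (hβ : ∀ i, β i ≠ i) :
    Q2 (U n) →+ (Fin r × Fin r → ℤ) × (Fin r → ZMod d) :=
  AddMonoidHom.prod
    -- The slot (i, β i) is free because its `loopClass` vanishes; it stores the multiplicity of the
    -- sources on O_i, read at the vertex 0.
    (AddMonoidHom.pi fun p => if p.2 = β p.1
      then (Finsupp.applyAddHom (pt n p.1 0)).comp (sources n) else edgeCount n p.1 p.2)
    (AddMonoidHom.pi fun i => torsionCoord hd hd2 hr hβ i)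

theorem cycleCoord_fst {d : ℕ} (hd : ∀ i, d ∣ n i) (hd2 : d ∣ 2) (hr : d = 1 ∨ r = 3)
    {β : Fin r → Fin r} (hβ : ∀ i, β i ≠ i) (x : Q2 (U n)) (p : Fin r × Fin r) :
    (cycleCoord hd hd2 hr hβ x).1 p =
      if p.2 = β p.1 then sources n x (pt n p.1 0) else edgeCount n p.1 p.2 x := by
  change (if p.2 = β p.1 then (Finsupp.applyAddHom (pt n p.1 0)).comp (sources n)
    else edgeCount n p.1 p.2) x = _
  split_ifs <;> rfl

theorem cycleCoord_snd {d : ℕ} (hd : ∀ i, d ∣ n i) (hd2 : d ∣ 2) (hr : d = 1 ∨ r = 3)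
    {β : Fin r → Fin r} (hβ : ∀ i, β i ≠ i) (x : Q2 (U n)) (i : Fin r) :
    (cycleCoord hd hd2 hr hβ x).2 i = torsionCoord hd hd2 hr hβ i x := rfl

/-- On a cycle the sources are constant along each orbit, so vanishing at 0 kills them entirely; the
normal form then has no terms left. -/
theorem eq_zero_of_cycleCoord_eq_zero (hn : ∀ i, 0 < n i) {d : ℕ} (hd : ∀ i, d ∣ n i)
    (hd2 : d ∣ 2) (hr : d = 1 ∨ r = 3) {β : Fin r → Fin r} (hβ : ∀ i, β i ≠ i)
    (hτ : ∀ i, d • tau n β i = 0) {x : Q2 (U n)} (hx : x ∈ H2 (U n))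
    (h : cycleCoord hd hd2 hr hβ x = 0) : x = 0 := by
  have h1 : ∀ p : Fin r × Fin r,
      (if p.2 = β p.1 then sources n x (pt n p.1 0) else edgeCount n p.1 p.2 x) = 0 := by
    intro p
    rw [← cycleCoord_fst hd hd2 hr hβ, h]
    rfl
  have h2 : ∀ i, torsionCoord hd hd2 hr hβ i x = 0 := by
    intro i
    rw [← cycleCoord_snd, h]
    rfl
  have h3 : sources n x = 0 := by
    ext a
    obtain ⟨m, hm⟩ := exists_eq_pt hn a
    rw [hm, sources_pt_of_mem_H2 hx]
    simpa using h1 (a.index, β a.index)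
  have h4 : ∀ i j, edgeCount n i j x • loopClass n β i j = 0 := by
    intro i j
    by_cases hj : j = β i
    · subst hj
      simp [loopClass, hβ]
    · have := h1 (i, j)
      rw [if_neg hj] at this
      rw [this, zero_zsmul]
  rw [chain_normal_form hn hd hd2 hr hβ hτ x, h3]
  simp [h2, h4]

/-- The sum of the vertices of the `i`-th orbit. -/
noncomputable def orbitSum (n : Fin r → ℕ) (hn : ∀ i, 0 < n i) (i : Fin r) : U n →₀ ℤ :=
  have : NeZero (n i) := ⟨(hn i).ne'⟩
  ∑ a : ZMod (n i), Finsupp.single (⟨i, a⟩ : U n) 1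

theorem orbitSum_pt_zero (hn : ∀ i, 0 < n i) (i j : Fin r) :
    orbitSum n hn i (pt n j 0) = if j = i then 1 else 0 := by
  have : NeZero (n i) := ⟨(hn i).ne'⟩
  rw [orbitSum, Finsupp.finsetSum_apply]
  by_cases h : j = i
  · subst h
    rw [Finset.sum_eq_single 0]
    · simp [pt]
    · intro a _ ha
      rw [Finsupp.single_eq_of_ne]
      intro h
      simp only [pt, U.mk.injEq, heq_eq_eq, true_and, Nat.cast_zero] at h
      exact ha h.symm
    · simp
  · rw [if_neg h]
    refine Finset.sum_eq_zero fun a _ => Finsupp.single_eq_of_ne fun h' => ?_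
    exact h (congrArg U.index h')

theorem mapDomain_succ_orbitSum (hn : ∀ i, 0 < n i) (i : Fin r) :
    (orbitSum n hn i).mapDomain succ = orbitSum n hn i := by
  have : NeZero (n i) := ⟨(hn i).ne'⟩
  rw [orbitSum, Finsupp.mapDomain_finsetSum]
  simp only [Finsupp.mapDomain_single]
  exact Equiv.sum_comp (Equiv.addRight (1 : ZMod (n i)))
    fun a => Finsupp.single (⟨i, a⟩ : U n) (1 : ℤ)

theorem sources_leave {β : Fin r → Fin r} (hβ : ∀ i, β i ≠ i) (v : U n →₀ ℤ) :
    sources n (leave n β v) = v := by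
  have : (sources n).comp (leave n β) = AddMonoidHom.id _ := by
    refine Finsupp.addHom_ext' fun v => AddMonoidHom.ext_int ?_
    simp [(hβ _).symm]
  exact DFunLike.congr_fun this v

theorem edgeCount_leave {β : Fin r → Fin r} {i j : Fin r} (h : j ≠ β i) (v : U n →₀ ℤ) :
    edgeCount n i j (leave n β v) = 0 := by
  have : (edgeCount n i j).comp (leave n β) = 0 := by
    refine Finsupp.addHom_ext' fun v => AddMonoidHom.ext_int ?_
    have : ¬ (v.index = i ∧ β v.index = j) := by
      rintro ⟨rfl, h'⟩
      exact h h'.symm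
    simp [this]
  exact DFunLike.congr_fun this v

theorem torsionCoord_leave {d : ℕ} (hd : ∀ i, d ∣ n i) (hd2 : d ∣ 2) (hr : d = 1 ∨ r = 3)
    {β : Fin r → Fin r} (hβ : ∀ i, β i ≠ i) (i : Fin r) (v : U n →₀ ℤ) :
    torsionCoord hd hd2 hr hβ i (leave n β v) = 0 := by
  have : (torsionCoord hd hd2 hr hβ i).comp (leave n β) = 0 := by
    refine Finsupp.addHom_ext' fun v => AddMonoidHom.ext_int ?_
    by_cases h : v.index = i <;> simp [h, hβ]
  exact DFunLike.congr_fun this v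

/-- The cycles dual to the integral coordinates. -/
noncomputable def basisCycle (n : Fin r → ℕ) (hn : ∀ i, 0 < n i) (β : Fin r → Fin r)
    (p : Fin r × Fin r) : Q2 (U n) :=
  if p.2 = β p.1 then leave n β (orbitSum n hn p.1) else loopClass n β p.1 p.2

theorem sources_loopClass {β : Fin r → Fin r} (hβ : ∀ i, β i ≠ i) (i j : Fin r) :
    sources n (loopClass n β i j) = 0 := by
  by_cases h : j = i
  · simp [loopClass, h]
  · simp [loopClass, h, Ne.symm h, (hβ i).symm]

theorem sources_tau {β : Fin r → Fin r} (i : Fin r) : sources n (tau n β i) = 0 := by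
  rw [tau, map_sub, sources_edge, sources_edge]
  exact sub_self _

theorem mem_H2_of_sources {x : Q2 (U n)} (h : sources n x = 0) : x ∈ H2 (U n) := by
  change d2bar (U n) x = 0
  rw [d2bar_eq_sources, h]
  simp

theorem basisCycle_mem_H2 (hn : ∀ i, 0 < n i) {β : Fin r → Fin r} (hβ : ∀ i, β i ≠ i)
    (p : Fin r × Fin r) : basisCycle n hn β p ∈ H2 (U n) := by
  by_cases h : p.2 = β p.1
  · change d2bar (U n) _ = 0
    rw [basisCycle, if_pos h, d2bar_eq_sources, sources_leave hβ, mapDomain_succ_orbitSum, sub_self]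
  · rw [basisCycle, if_neg h]
    exact mem_H2_of_sources (sources_loopClass hβ _ _)

/-- Leaving every vertex of O_i once towards `β i` gives source multiplicity 1 and no other
coordinate. A `loopClass` has no sources, and its correcting edge to `β i` is not counted by any
retained edge count. -/
theorem cycleCoord_basisCycle (hn : ∀ i, 0 < n i) {d : ℕ} (hd : ∀ i, d ∣ n i)
    (hd2 : d ∣ 2) (hr : d = 1 ∨ r = 3) {β : Fin r → Fin r} (hβ : ∀ i, β i ≠ i)
    (p : Fin r × Fin r) :
    cycleCoord hd hd2 hr hβ (basisCycle n hn β p) = (Pi.single p 1, 0) := by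
  obtain ⟨i, j⟩ := p
  refine Prod.ext (funext ?_) (funext fun k => ?_)
  · rintro ⟨k, l⟩
    rw [cycleCoord_fst]
    change _ = (Pi.single (i, j) 1 : Fin r × Fin r → ℤ) (k, l)
    rw [Pi.single_apply]
    simp only [basisCycle, Prod.mk.injEq]
    by_cases hj : j = β i <;> by_cases hl : l = β k
    · rw [if_pos hj, if_pos hl, sources_leave hβ, orbitSum_pt_zero]
      subst hj hl
      refine if_congr ⟨fun h => ⟨h, congrArg β h⟩, And.left⟩ rfl rfl
    · rw [if_pos hj, if_neg hl, edgeCount_leave hl, if_neg]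
      rintro ⟨rfl, rfl⟩
      exact hl hj
    · rw [if_neg hj, if_pos hl, sources_loopClass hβ, if_neg]
      · rfl
      · rintro ⟨rfl, rfl⟩
        exact hj hl
    · rw [if_neg hj, if_neg hl, loopClass, map_sub, edgeCount_edge, index_pt, index_pt]
      have h0 : edgeCount n k l (if j = i then 0 else edge (pt n i 0) (pt n (β i) 0)) = 0 := by
        split_ifs
        · exact map_zero _
        · rw [edgeCount_edge, if_neg]
          rintro ⟨rfl, rfl⟩
          exact hl rfl
      rw [h0, sub_zero]
      exact if_congr ⟨fun h => ⟨h.1.symm, h.2.symm⟩, fun h => ⟨h.1.symm, h.2.symm⟩⟩ rfl rfl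
  · rw [cycleCoord_snd]
    by_cases hj : j = β i
    · simp only [basisCycle, if_pos hj]
      exact torsionCoord_leave ..
    · simp only [basisCycle, if_neg hj, loopClass, map_sub]
      have h0 : ∀ l, torsionCoord hd hd2 hr hβ k (edge (pt n i 0) (pt n l 0)) = 0 := by
        intro l
        simp
      split_ifs <;> simp only [h0, map_zero, sub_self, Pi.zero_apply]

theorem cycleCoord_tau {d : ℕ} (hd : ∀ i, d ∣ n i) (hd2 : d ∣ 2) (hr : d = 1 ∨ r = 3)
    {β : Fin r → Fin r} (hβ : ∀ i, β i ≠ i) (i : Fin r) :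
    cycleCoord hd hd2 hr hβ (tau n β i) = (0, Pi.single i 1) := by
  refine Prod.ext (funext fun p => ?_) (funext fun k => ?_)
  · rw [cycleCoord_fst, sources_tau]
    have h : edgeCount n p.1 p.2 (tau n β i) = 0 := by
      rw [tau, map_sub, edgeCount_edge, edgeCount_edge]
      exact sub_self _
    simp [h]
  · rw [cycleCoord_snd, torsionCoord_tau]
    exact (if_congr eq_comm rfl rfl).trans (Pi.single_apply i 1 k).symm

theorem exists_cycleCoord_eq (hn : ∀ i, 0 < n i) {d : ℕ} (hd : ∀ i, d ∣ n i)
    (hd2 : d ∣ 2) (hr : d = 1 ∨ r = 3) {β : Fin r → Fin r} (hβ : ∀ i, β i ≠ i)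
    (y : (Fin r × Fin r → ℤ) × (Fin r → ZMod d)) :
    ∃ x ∈ H2 (U n), cycleCoord hd hd2 hr hβ x = y := by
  obtain ⟨z, s⟩ := y
  choose k hk using fun i => ZMod.intCast_surjective (s i)
  refine ⟨∑ p, z p • basisCycle n hn β p + ∑ i, k i • tau n β i,
    add_mem (sum_mem fun p _ => zsmul_mem (basisCycle_mem_H2 hn hβ p) _)
      (sum_mem fun i _ => zsmul_mem (mem_H2_of_sources (sources_tau i)) _), ?_⟩
  rw [map_add, map_sum, map_sum]
  simp only [map_zsmul, cycleCoord_basisCycle, cycleCoord_tau]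
  refine Prod.ext (funext fun p => ?_) (funext fun i => ?_)
  · simp [Prod.fst_sum, Finset.sum_apply, Pi.single_apply]
  · simp [Prod.snd_sum, Finset.sum_apply, Pi.single_apply, hk]

theorem nonempty_H2_equiv (hn : ∀ i, 0 < n i) {d : ℕ} (hd : ∀ i, d ∣ n i)
    (hd2 : d ∣ 2) (hr : d = 1 ∨ r = 3) {β : Fin r → Fin r} (hβ : ∀ i, β i ≠ i)
    (hτ : ∀ i, d • tau n β i = 0) :
    Nonempty (H2 (U n) ≃+ (Fin r × Fin r → ℤ) × (Fin r → ZMod d)) := by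
  refine ⟨AddEquiv.ofBijective ((cycleCoord hd hd2 hr hβ).comp (H2 (U n)).subtype) ⟨?_, ?_⟩⟩
  · rw [injective_iff_map_eq_zero]
    rintro ⟨x, hx⟩ h
    exact Subtype.ext (eq_zero_of_cycleCoord_eq_zero hn hd hd2 hr hβ hτ hx h)
  · intro y
    obtain ⟨x, hx, h⟩ := exists_cycleCoord_eq hn hd hd2 hr hβ y
    exact ⟨⟨x, hx⟩, h⟩

end HomologyU

end AbQuandle

theorem mainTheorem9 (r : ℕ) (hr : 3 ≤ r) (n : Fin r → ℕ) (hn : ∀ i, 0 < n i) :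
    -- the parameter group
    (∃ M : Fin r → AbQuandle.FPMatrix r,
      AbQuandle.HasParameters M (AbQuandle.U n) AbQuandle.U.index) ∧
    (∀ M : Fin r → AbQuandle.FPMatrix r,
      AbQuandle.HasParameters M (AbQuandle.U n) AbQuandle.U.index →
        Nonempty (AbQuandle.ParameterGroup M ≃+ ZMod (Nat.gcd (Finset.univ.gcd n) 2))) ∧
    -- three orbits
    (r = 3 →
      Nonempty (AbQuandle.H2 (AbQuandle.U n) ≃+
        (Fin 9 → ℤ) × (Fin 3 → ZMod (Nat.gcd (Finset.univ.gcd n) 2))) ∧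
      ∀ M : Fin r → AbQuandle.FPMatrix r,
        AbQuandle.HasParameters M (AbQuandle.U n) AbQuandle.U.index →
          ∀ a : AbQuandle.U n,
            Nonempty (AbQuandle.torsionGroup a ≃+ AbQuandle.ParameterGroup M)) ∧
    -- four orbits or more
    (4 ≤ r →
      Nonempty (AbQuandle.H2 (AbQuandle.U n) ≃+ (Fin (r ^ 2) → ℤ)) ∧
      ∀ a : AbQuandle.U n, AbQuandle.torsionGroup a = ⊥) := by
  -- Any selection of another orbit for each orbit will do.
  choose β hβ' using fun i => AbQuandle.exists_ne_ne hr i i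
  have hβ : ∀ i, β i ≠ i := fun i => (hβ' i).1
  refine ⟨AbQuandle.exists_hasParameters n (by omega) hn,
    fun M hM => hM.nonempty_parameterGroup_equiv hr, fun h3 => ?_, fun h4 => ?_⟩
  · have hd := AbQuandle.torsionOrder_dvd n
    have hd2 := AbQuandle.torsionOrder_dvd_two n
    have hτ : ∀ i, AbQuandle.torsionOrder n • AbQuandle.tau n β i = 0 := fun i =>
      AbQuandle.torsionOrder_nsmul_eq_zero (AbQuandle.nsmul_tau hβ hn i)
        (AbQuandle.two_nsmul_tau hβ hr hn i)
    refine ⟨?_, fun M hM a => ?_⟩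
    · obtain ⟨e⟩ := AbQuandle.nonempty_H2_equiv hn hd hd2 (Or.inr h3) hβ hτ
      have e₁ : Fin r × Fin r ≃ Fin 9 := Fintype.equivFinOfCardEq (by simp [h3])
      have e₂ : Fin r ≃ Fin 3 := finCongr h3
      exact ⟨e.trans (AddEquiv.prodCongr (AddEquiv.arrowCongr e₁ (AddEquiv.refl ℤ))
        (AddEquiv.arrowCongr e₂ (AddEquiv.refl _)))⟩
    · obtain ⟨e⟩ := AbQuandle.torsionGroup_equiv hd hd2 (Or.inr h3) hβ hn hτ a
      obtain ⟨e'⟩ := hM.nonempty_parameterGroup_equiv hr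
      exact ⟨e.symm.trans e'.symm⟩
  · have hτ := AbQuandle.tau_eq_zero hβ h4 hn
    refine ⟨?_, fun a => ?_⟩
    -- Since `tau` vanishes, d = 1 is allowed for any number of orbits, and the factor (ℤ/1)^r is
    -- trivial.
    · obtain ⟨e⟩ := AbQuandle.nonempty_H2_equiv hn (d := 1) (fun i => one_dvd _) (one_dvd _)
        (Or.inl rfl) hβ (fun i => by rw [hτ, smul_zero])
      have e₁ : Fin r × Fin r ≃ Fin (r ^ 2) := Fintype.equivFinOfCardEq (by simp [sq])
      exact ⟨(e.trans AddEquiv.prodUnique).trans (AddEquiv.arrowCongr e₁ (AddEquiv.refl ℤ))⟩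
    · rw [AbQuandle.torsionGroup_eq_zmultiples hβ hn, hτ, AddSubgroup.zmultiples_zero_eq_bot]
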